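/- **Conventions.** A partition is a sequence $\lambda=(\lambda_1^{\rho_1}>\lambda_2^{\rho_2}>\cdots>\lambda_k^{\rho_k})$ with $k\ge 0$, strictly decreasing positive integers $\lambda_i$ and positive integers $\rho_i$. Let $\widetilde\lambda$ be the partition obtained by deleting the first column, i.e. by replacing each part $\lambda_i$ by $\lambda_i-1$ and dropping zero parts. For a discrete valuation ring $R$ with uniformizer $\pi$ and finite residue field with $q$ elements put $A_\lambda=\bigoplus_{i=1}^k (R/\pi^{\lambda_i})^{\rho_i}$ and $G_\lambda=\operatorname{Aut}_R(A_\lambda)$. Let $P=\{(v,l)\in\mathbb Z^2: 0\le v<l\}$, partially ordered by $(v,l)\le(v',l')$ iff $v\ge v'$ and $l-v\le l'-v'$. Let $J(P)_\lambda$ be the set of order ideals $I$ of $P$ that are generated by their set $\max I$ of maximal elements and for which every $(v,l)\in\max I$ has $l\in\{\lambda_1,\dots,\lambda_k\}$. For $I\in J(P)_\lambda$ let $e_I\in A_\lambda$ be the element whose first coordinate in the block $(R/\pi^{l})^{\rho}$ of the part $l$ is $\pi^{v}$ for every $(v,l)\in\max I$, and all of whose other coordinates are $0$; let $(G_\lambda)_I$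 be the stabilizer of $e_I$ in $G_\lambda$. The ideal $I$ is of height zero if $\max I$ contains an element $(0,l)$, and principal if $\max I$ has at most one element. Let $$n_\lambda(q)=|G_\lambda\backslash(A_\lambda\times A_\lambda)|,\qquad n_{\lambda,I}(q)=|(G_\lambda)_I\backslash A_\lambda|,\qquad n^1_{\lambda,I}(q)=|(G_\lambda)_I\backslash \pi A_\lambda|,$$ where $G_\lambda$ acts diagonally on pairs. **Theorem.** For every partition $\lambda$ and every $I\in J(P)_\lambda$, the numbers $n_\lambda(q)$, $n_{\lambda,I}(q)$ and $n^1_{\lambda,I}(q)$ are given by polynomials in $q$ with integer coefficients which depend only on $\lambda$ (and $I$), not on $R$ and $\pi$. Moreover: 1. If $I$ is a height zero principal ideal, then $n_{\lambda,I}(q)$ and $n^1_{\lambda,I}(q)$ have non-negative coefficients. 2. For every partition $\lambda$, $$n_\lambda(q)-n_{\widetilde\lambda}(q)=\sum_{I\in J(P)_\lambda\text{ of height zero}}\bigl(n_{\lambda,I}(q)+n^1_{\lambda,I}(q)\bigr)$$ as polynomials. If $\Lambda_1$ is a set of partitions such that $\lambda\in\Lambda_1$ implies $\widetilde\lambda\in\Lambda_1$,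 and if the polynomial $n_\lambda(q)-n_{\widetilde\lambda}(q)$ has non-negative coefficients for every $\lambda\in\Lambda_1$, then $n_\lambda(q)$ has non-negative coefficients for every $\lambda\in\Lambda_1$. 3. The positivity conjecture holds for $\lambda=(\lambda_1^{\rho_1}>(\lambda_1-1)^{\rho_2})$ with $\lambda_1>1$, $\rho_1,\rho_2\ge1$, and for $\lambda=(\lambda_1^{\rho_1})$ with $\lambda_1,\rho_1\ge1$: the polynomial $n_\lambda(q)$ has degree $\lambda_1$ and non-negative integer coefficients. -/

import Mathlib

universe u

namespace OrbitPairs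

/-- A partition `(λ₁^{ρ₁} > λ₂^{ρ₂} > ⋯ > λ_k^{ρ_k})` with positive parts `λ_i` and positive
multiplicities `ρ_i` (possibly `k = 0`), recorded by its multiplicity function: the parts are
the elements of the support, and `mult (λ_i) = ρ_i`. -/
@[ext]
structure Ptn where
  mult : ℕ →₀ ℕ
  mult_zero : mult 0 = 0

/-- Deletion of the first column of the tableau: every part decreases by one
(parts equal to one disappear). -/
noncomputable def Ptn.deleteColumn (μ : Ptn) : Ptn where
  mult := (μ.mult.comapDomain (fun l => l + 1) (fun _ _ _ _ h => Nat.succ_injective h)).erase 0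
  mult_zero := Finsupp.erase_same

theorem Ptn.deleteColumn_mult (μ : Ptn) (l : ℕ) (hl : 0 < l) :
    μ.deleteColumn.mult l = μ.mult (l + 1) := by
  simp only [Ptn.deleteColumn, Finsupp.erase_ne hl.ne']
  rfl

/-- The largest part `λ₁` (`0` for the empty partition). -/
def Ptn.largestPart (μ : Ptn) : ℕ := μ.mult.support.sup id

/-- The fundamental poset: pairs `(v, l)` with `0 ≤ v < l`. -/
@[ext]
structure FundPoset where
  v : ℕ
  l : ℕ
  v_lt : v < l

/-- `(v, l) ≤ (v', l')` if and only if `v ≥ v'` and `l - v ≤ l' - v'`. -/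
instance : PartialOrder FundPoset where
  le p p' := p'.v ≤ p.v ∧ p.l - p.v ≤ p'.l - p'.v
  le_refl p := ⟨le_rfl, le_rfl⟩
  le_trans p p' p'' h h' := ⟨h'.1.trans h.1, h.2.trans h'.2⟩
  le_antisymm p p' h h' := by
    obtain ⟨v, l, hv⟩ := p
    obtain ⟨v', l', hv'⟩ := p'
    simp only at h h'
    ext <;> simp only <;> omega

/-- The set `max I` of maximal elements of an order ideal. -/
def maxSet (I : LowerSet FundPoset) : Set FundPoset := {p | Maximal (· ∈ I) p}

/-- The set `P_λ` of the elements `(v, l)` of the fundamental poset such that `l` is a part. -/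
def partSet (μ : Ptn) : Set FundPoset := {p | p.l ∈ μ.mult.support}

/-- The set `J(P)_λ` of the order ideals of the fundamental poset that are generated by their
maximal elements, all of which lie in `P_λ`. -/
def PtnIdeal (μ : Ptn) : Type :=
  {I : LowerSet FundPoset // maxSet I ⊆ partSet μ ∧ I = lowerClosure (maxSet I)}

theorem partSet_finite (μ : Ptn) : (partSet μ).Finite := by
  have h : (Set.Iio (μ.mult.support.sup id + 1) ×ˢ Set.Iio (μ.mult.support.sup id + 1) :
      Set (ℕ × ℕ)).Finite := (Set.finite_Iio _).prod (Set.finite_Iio _)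
  refine Set.Finite.of_finite_image (f := fun p : FundPoset => (p.v, p.l)) (h.subset ?_) ?_
  · rintro _ ⟨p, hp, rfl⟩
    have h1 : p.l ≤ μ.mult.support.sup id := Finset.le_sup (f := id) hp
    have h2 := p.v_lt
    simp only [Set.mem_prod, Set.mem_Iio]
    omega
  · intro p _ p' _ hpp
    simp only [Prod.mk.injEq] at hpp
    exact FundPoset.ext hpp.1 hpp.2

instance (μ : Ptn) : Finite (PtnIdeal μ) := by
  have := (partSet_finite μ).finite_subsets.to_subtype
  refine Finite.of_injective
    (fun I : PtnIdeal μ => (⟨maxSet I.1, I.2.1⟩ : {s : Set FundPoset | s ⊆ partSet μ})) ?_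
  intro I J h
  have h' : maxSet I.1 = maxSet J.1 := congrArg Subtype.val h
  exact Subtype.ext (by rw [I.2.2, J.2.2, h'])

/-- The ideal is of height zero: some maximal element is of the form `(0, l)`. -/
def PtnIdeal.HeightZero {μ : Ptn} (I : PtnIdeal μ) : Prop := ∃ p ∈ maxSet I.1, p.v = 0

/-- The ideal is principal: it has at most one maximal element. -/
def PtnIdeal.IsPrincipal {μ : Ptn} (I : PtnIdeal μ) : Prop := (maxSet I.1).Subsingleton

/-- The index set of the cyclic summands: pairs `(λ_i, r)` with `r` one of `ρ_i` indices. -/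
abbrev Row (μ : Ptn) : Type := Σ l : μ.mult.support, Fin (μ.mult l)

section Module

variable (R : Type u) [CommRing R] (π : R) (μ : Ptn)

/-- The `R`-module `A_λ = ⨁ (R / π^{λ_i} R)^{ρ_i}`. -/
abbrev Mod : Type u := ∀ r : Row μ, R ⧸ Ideal.span {π ^ (r.1 : ℕ)}

/-- The automorphism group `G_λ` of the `R`-module `A_λ`. -/
abbrev Aut : Type u := Mod R π μ ≃ₗ[R] Mod R π μ

open Classical in
/-- The canonical element `e_I`: for every maximal element `(v, l)` of `I` the first coordinate
belonging to the part `l` is `π ^ v`, and all other coordinates vanish. (Two distinct maximal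
elements have distinct second entries, so that the choice below is no choice.) -/
noncomputable def canonicalElement (I : PtnIdeal μ) : Mod R π μ := fun r =>
  if h : (r.2 : ℕ) = 0 ∧ ∃ p ∈ maxSet I.1, p.l = r.1 then
    Ideal.Quotient.mk _ (π ^ h.2.choose.v)
  else 0

/-- The stabilizer `(G_λ)_I` of the canonical element `e_I` in `G_λ`. -/
noncomputable abbrev Stab (I : PtnIdeal μ) : Subgroup (Aut R π μ) :=
  MulAction.stabilizer (Aut R π μ) (canonicalElement R π μ I)

/-- The subset `π A_λ` with the action of a group of automorphisms. -/
def piMod (H : Subgroup (Aut R π μ)) : SubMulAction H (Mod R π μ) where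
  carrier := {x | ∃ y : Mod R π μ, π • y = x}
  smul_mem' := by
    rintro g _ ⟨y, rfl⟩
    exact ⟨g • y, (map_smul (g : Aut R π μ) π y).symm⟩

/-- The number of orbits of `G_λ` acting diagonally on `A_λ × A_λ`. -/
noncomputable def numPairOrbits : ℕ :=
  Nat.card (MulAction.orbitRel.Quotient (Aut R π μ) (Mod R π μ × Mod R π μ))

/-- The number of orbits of `(G_λ)_I` on `A_λ`. -/
noncomputable def numStabOrbits (I : PtnIdeal μ) : ℕ :=
  Nat.card (MulAction.orbitRel.Quotient (Stab R π μ I) (Mod R π μ))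

/-- The number of orbits of `(G_λ)_I` on `π A_λ`. -/
noncomputable def numStabOrbitsPi (I : PtnIdeal μ) : ℕ :=
  Nat.card (MulAction.orbitRel.Quotient (Stab R π μ I) (piMod R π μ (Stab R π μ I)))

end Module

/-- All coefficients of the integer polynomial are non-negative. -/
def NonnegCoeffs (f : Polynomial ℤ) : Prop := ∀ i, 0 ≤ f.coeff i

/-- The partitions `(a^ρ > (a-1)^σ)` with `a > 1`, `ρ, σ ≥ 1`, and `(a^ρ)` with `a, ρ ≥ 1`. -/
def nearRectangular : Set Ptn :=
  {μ | (∃ a ρ σ : ℕ, 1 < a ∧ 0 < ρ ∧ 0 < σ ∧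
        μ.mult = Finsupp.single a ρ + Finsupp.single (a - 1) σ) ∨
      (∃ a ρ : ℕ, 0 < a ∧ 0 < ρ ∧ μ.mult = Finsupp.single a ρ)}

end OrbitPairs

open OrbitPairs

/-! In a finite module, two families that endomorphisms carry to each other are conjugate under an
automorphism (`exists_linearEquiv_of_end`). Orbit questions thus reduce to which elements
homomorphisms of cyclic modules can reach, that is, to valuations.

Fix `e = e_I` in `A = A_λ`. Endomorphisms killing `e` are homomorphisms from `A/Re` to `A`, and
`A/Re` is again a product of cyclic modules, with exponents `nu` read off from `max I`. Their values
at `y` fill a box, `π ^ c i` dividing coordinate `i`, where `c = cvec` depends only on the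
valuations of `y` in `A/Re`. So `y` and `y'` are in one orbit of the stabilizer iff they have the
same `c` and differ by an element of its box (`stabRel_iff`). For given `c`, coordinates off the
support of `e` lie in the box anyway, and the admissible coordinates on the support form a union of
cosets, because suitable unipotent maps are automorphisms fixing `e` (`stabRel_add`). The number of
orbits with vector `c` is therefore a polynomial in `q` divided by a power `q ^ d`. Taking the rings
of `p`-adic integers for all `p`, integrality of the count forces `X ^ d` to divide the polynomial
(`X_pow_denomExp_dvd`).

If `I` is principal of height zero, `e` generates a cyclic summand; no valuation on the support is
left to choose, and each `c` contributes a power of `X` or nothing (`orbitPoly_eq`).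

For the difference formula, pairs `(x, y)` are sorted by whether `x`, or else `y`, lies outside
`πA`. Each element is conjugate to exactly one `e_I`, which is outside `πA` iff `I` has height zero,
and pairs in `πA` have the same orbits as pairs for the partition without its first column
(`numPairOrbits_eq_add`). Positivity follows by induction on the largest part. If the parts differ
by at most one, all height zero ideals are principal, and the ideal of `(0, λ₁)` supplies the top
coefficient. -/

namespace OrbitPairs

open Polynomial

/-! ### Conjugacy under automorphisms from conjugacy under endomorphisms. -/

section Degeneration

variable {R : Type*} {M : Type*} [CommRing R] [AddCommGroup M] [Module R M] [Finite M]

theorem finite_end : Finite (M →ₗ[R] M) :=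
  Finite.of_injective (fun f : M →ₗ[R] M => (f : M → M)) DFunLike.coe_injective

/-- Two families of elements of a finite module which are carried to each other by endomorphisms
are carried to each other by an automorphism. -/
theorem exists_linearEquiv_of_end {κ : Type*} (x x' : κ → M) (f g : M →ₗ[R] M)
    (hf : ∀ k, f (x k) = x' k) (hg : ∀ k, g (x' k) = x k) :
    ∃ h : M ≃ₗ[R] M, ∀ k, h (x k) = x' k := by
  classical
  have : Finite (M →ₗ[R] M) := finite_end
  have := Fintype.ofFinite (M →ₗ[R] M)
  have : Finite (Submodule R M) :=
    Finite.of_injective (fun K : Submodule R M => (K : Set M)) SetLike.coe_injective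
  have := Fintype.ofFinite (Submodule R M)
  -- Endomorphisms taking `x` to `z` are sorted by kernel: `H` asks for a kernel containing `K`, `E`
  -- for the kernel `K`. An automorphism is an element of `E ⊥ x'`.
  let H (K : Submodule R M) (z : κ → M) : Finset (M →ₗ[R] M) :=
    {φ | K ≤ LinearMap.ker φ ∧ ∀ k, φ (x k) = z k}
  let E (K : Submodule R M) (z : κ → M) : Finset (M →ₗ[R] M) :=
    {φ | LinearMap.ker φ = K ∧ ∀ k, φ (x k) = z k}
  have hH (K : Submodule R M) : (H K x).card = (H K x').card := by
    by_cases hK : ∃ φ₀, φ₀ ∈ H K x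
    · obtain ⟨φ₀, h₀⟩ := hK
      have h₀' : K ≤ LinearMap.ker φ₀ ∧ ∀ k, φ₀ (x k) = x k := by simpa [H] using h₀
      have hker (m : M) (hm : m ∈ K) : φ₀ m = 0 := h₀'.1 hm
      -- Both sets are cosets of the group of endomorphisms killing `K` and all `x k`, with base
      -- points `φ₀` and `f ∘ₗ φ₀`.
      refine Finset.card_bij' (fun φ _ => φ - φ₀ + f ∘ₗ φ₀) (fun φ _ => φ + φ₀ - f ∘ₗ φ₀) ?_ ?_ ?_ ?_
      · intro φ hφ
        have hφ' : K ≤ LinearMap.ker φ ∧ ∀ k, φ (x k) = x k := by simpa [H] using hφ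
        have : K ≤ LinearMap.ker (φ - φ₀ + f ∘ₗ φ₀) ∧
            ∀ k, (φ - φ₀ + f ∘ₗ φ₀) (x k) = x' k := by
          refine ⟨fun m hm => ?_, fun k => ?_⟩
          · have := hφ'.1 hm
            simp_all
          · simp [hφ'.2, h₀'.2, hf]
        simpa [H] using this
      · intro φ hφ
        have hφ' : K ≤ LinearMap.ker φ ∧ ∀ k, φ (x k) = x' k := by simpa [H] using hφ
        have : K ≤ LinearMap.ker (φ + φ₀ - f ∘ₗ φ₀) ∧
            ∀ k, (φ + φ₀ - f ∘ₗ φ₀) (x k) = x k := by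
          refine ⟨fun m hm => ?_, fun k => ?_⟩
          · have := hφ'.1 hm
            simp_all
          · simp [hφ'.2, h₀'.2, hf]
        simpa [H] using this
      · exact fun φ _ => by abel
      · exact fun φ _ => by abel
    · have h1 : H K x = ∅ := Finset.eq_empty_of_forall_notMem fun φ hφ => hK ⟨φ, hφ⟩
      have h2 : H K x' = ∅ := by
        refine Finset.eq_empty_of_forall_notMem fun φ hφ => hK ⟨g ∘ₗ φ, ?_⟩
        have hφ' : K ≤ LinearMap.ker φ ∧ ∀ k, φ (x k) = x' k := by simpa [H] using hφ
        have : K ≤ LinearMap.ker (g ∘ₗ φ) ∧ ∀ k, (g ∘ₗ φ) (x k) = x k := by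
          refine ⟨fun m hm => ?_, fun k => ?_⟩
          · have := hφ'.1 hm
            simp_all
          · simp [hφ'.2, hg]
        simpa [H] using this
      rw [h1, h2]
  have hsum (K : Submodule R M) (z : κ → M) :
      (H K z).card = (E K z).card + ∑ K' ∈ Finset.univ.filter (K < ·), (E K' z).card := by
    have h1 := Finset.card_eq_sum_card_fiberwise (s := H K z) (f := LinearMap.ker)
      (t := Finset.univ.filter (K ≤ ·)) (by
        intro φ hφ
        have hφ' : K ≤ LinearMap.ker φ ∧ ∀ k, φ (x k) = z k := by simpa [H] using hφ
        simpa using hφ'.1)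
    have h2 : Finset.univ.filter (K ≤ ·) = insert K (Finset.univ.filter (K < ·)) := by
      ext K'
      simp [le_iff_eq_or_lt, eq_comm]
    have h3 : ∀ K', K ≤ K' → ((H K z).filter (fun φ => LinearMap.ker φ = K')) = E K' z := by
      intro K' hK'
      ext φ
      simp only [H, E, Finset.mem_filter, Finset.mem_univ, true_and]
      constructor
      · rintro ⟨⟨_, b⟩, c⟩
        exact ⟨c, b⟩
      · rintro ⟨c, b⟩
        exact ⟨⟨c ▸ hK', b⟩, c⟩
    rw [h1, h2, Finset.sum_insert (by simp), h3 K le_rfl]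
    congr 1
    refine Finset.sum_congr rfl fun K' hK' => ?_
    rw [h3 K' (by simpa using hK' : K < K').le]
  have hE (K : Submodule R M) : (E K x).card = (E K x').card := by
    -- Descending induction: the strictly larger kernels contribute equally to both `H`-counts, so
    -- the remaining `E`-counts agree.
    induction K using WellFoundedGT.induction with
    | ind K ih =>
      have h1 := hsum K x
      have h2 := hsum K x'
      have h3 : ∑ K' ∈ Finset.univ.filter (K < ·), (E K' x).card =
          ∑ K' ∈ Finset.univ.filter (K < ·), (E K' x').card :=
        Finset.sum_congr rfl fun K' hK' => ih K' (by simpa using hK')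
      have := hH K
      omega
  have hid : LinearMap.id ∈ E ⊥ x := by simp [E]
  have hpos : 0 < (E ⊥ x').card := hE ⊥ ▸ Finset.card_pos.mpr ⟨_, hid⟩
  obtain ⟨φ, hφ⟩ := Finset.card_pos.mp hpos
  have hφ' : LinearMap.ker φ = ⊥ ∧ ∀ k, φ (x k) = x' k := by simpa [E] using hφ
  have hinj : Function.Injective φ := LinearMap.ker_eq_bot.mp hφ'.1
  exact ⟨LinearEquiv.ofBijective φ ⟨hinj, Finite.surjective_of_injective hinj⟩, hφ'.2⟩

end Degeneration
-- Cyclic modules and divisibility by powers of `π`.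
section Cyclic

variable {R : Type*} [CommRing R] (π : R)

/-- The cyclic module `R / π ^ k`. -/
abbrev Cyc (k : ℕ) := R ⧸ Ideal.span {π ^ k}

theorem Cyc.smul_one_eq_zero {k : ℕ} {r : R} : r • (1 : Cyc π k) = 0 ↔ π ^ k ∣ r := by
  rw [← Ideal.mem_span_singleton, ← Ideal.Quotient.eq_zero_iff_mem, Algebra.smul_def, mul_one]
  rfl

theorem Cyc.mk_eq_smul_one (k : ℕ) (r : R) :
    Ideal.Quotient.mk (Ideal.span {π ^ k}) r = r • (1 : Cyc π k) := by
  rw [Algebra.smul_def, mul_one]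
  rfl

theorem Cyc.exists_smul_one {k : ℕ} (a : Cyc π k) : ∃ r : R, a = r • (1 : Cyc π k) := by
  obtain ⟨r, rfl⟩ := Ideal.Quotient.mk_surjective a
  exact ⟨r, Cyc.mk_eq_smul_one π k r⟩

theorem Cyc.pow_smul_eq_zero {k n : ℕ} (h : k ≤ n) (a : Cyc π k) : π ^ n • a = 0 := by
  obtain ⟨r, rfl⟩ := Cyc.exists_smul_one π a
  rw [smul_smul, Cyc.smul_one_eq_zero]
  exact (pow_dvd_pow π h).mul_right r

theorem Cyc.smul_one_eq_iff {k : ℕ} {r s : R} :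
    r • (1 : Cyc π k) = s • (1 : Cyc π k) ↔ π ^ k ∣ r - s := by
  rw [← sub_eq_zero, ← sub_smul, Cyc.smul_one_eq_zero]

variable {M N : Type*} [AddCommGroup M] [Module R M] [AddCommGroup N] [Module R N]

/-- The homomorphism from `R / π ^ k` which maps the generator to a given element. -/
def cycLift (k : ℕ) (m : M) (hm : π ^ k • m = 0) : Cyc π k →ₗ[R] M :=
  Submodule.liftQ (Ideal.span {π ^ k}) (LinearMap.toSpanSingleton R M m) (by
    rw [Ideal.span, Submodule.span_le, Set.singleton_subset_iff]
    simpa using hm)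

theorem cycLift_one {k : ℕ} {m : M} (hm : π ^ k • m = 0) : cycLift π k m hm 1 = m := by
  have : cycLift π k m hm (Submodule.Quotient.mk 1) = (1 : R) • m := Submodule.liftQ_apply _ _ _
  rw [one_smul] at this
  exact this

theorem Cyc.hom_ext {k : ℕ} {φ ψ : Cyc π k →ₗ[R] M} (h : φ 1 = ψ 1) : φ = ψ := by
  refine LinearMap.ext fun a => ?_
  obtain ⟨r, rfl⟩ := Cyc.exists_smul_one π a
  rw [map_smul, map_smul, h]

/-- The element is divisible by `π ^ n`. -/
def PowDvd (n : ℕ) (a : M) : Prop := ∃ b : M, π ^ n • b = a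

variable {π}

theorem PowDvd.zero_left (a : M) : PowDvd π 0 a := ⟨a, by simp⟩

theorem PowDvd.zero_right (n : ℕ) : PowDvd π n (0 : M) := ⟨0, by simp⟩

theorem PowDvd.mono {m n : ℕ} {a : M} (h : PowDvd π n a) (hmn : m ≤ n) : PowDvd π m a := by
  obtain ⟨b, rfl⟩ := h
  exact ⟨π ^ (n - m) • b, by rw [smul_smul, ← pow_add, Nat.add_sub_cancel' hmn]⟩

theorem PowDvd.add {n : ℕ} {a b : M} (ha : PowDvd π n a) (hb : PowDvd π n b) :
    PowDvd π n (a + b) := by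
  obtain ⟨a, rfl⟩ := ha
  obtain ⟨b, rfl⟩ := hb
  exact ⟨a + b, smul_add _ _ _⟩

theorem PowDvd.neg {n : ℕ} {a : M} (ha : PowDvd π n a) : PowDvd π n (-a) := by
  obtain ⟨a, rfl⟩ := ha
  exact ⟨-a, smul_neg _ _⟩

theorem PowDvd.sub {n : ℕ} {a b : M} (ha : PowDvd π n a) (hb : PowDvd π n b) :
    PowDvd π n (a - b) := by
  rw [sub_eq_add_neg]
  exact ha.add hb.neg

theorem PowDvd.smul {n : ℕ} {a : M} (r : R) (ha : PowDvd π n a) : PowDvd π n (r • a) := by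
  obtain ⟨a, rfl⟩ := ha
  exact ⟨r • a, smul_comm _ _ _⟩

theorem PowDvd.pow_smul {m n : ℕ} {a : M} (ha : PowDvd π n a) : PowDvd π (m + n) (π ^ m • a) := by
  obtain ⟨a, rfl⟩ := ha
  exact ⟨a, by rw [pow_add, mul_smul]⟩

theorem PowDvd.map {n : ℕ} {a : M} (φ : M →ₗ[R] N) (ha : PowDvd π n a) : PowDvd π n (φ a) := by
  obtain ⟨a, rfl⟩ := ha
  exact ⟨φ a, (map_smul _ _ _).symm⟩

theorem PowDvd.sum {κ : Type*} {n : ℕ} (s : Finset κ) (f : κ → M)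
    (h : ∀ i ∈ s, PowDvd π n (f i)) : PowDvd π n (∑ i ∈ s, f i) :=
  Finset.sum_induction f (PowDvd π n) (fun _ _ => PowDvd.add) (PowDvd.zero_right n) h

theorem powDvd_pi {κ : Type*} {X : κ → Type*} [∀ i, AddCommGroup (X i)] [∀ i, Module R (X i)]
    {n : ℕ} {a : ∀ i, X i} : PowDvd π n a ↔ ∀ i, PowDvd π n (a i) := by
  constructor
  · rintro ⟨b, rfl⟩ i
    exact ⟨b i, rfl⟩
  · intro h
    choose b hb using h
    exact ⟨b, funext hb⟩

theorem Cyc.powDvd_eq_zero {k n : ℕ} (h : k ≤ n) {a : Cyc π k} : PowDvd π n a ↔ a = 0 := by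
  constructor
  · rintro ⟨b, rfl⟩
    exact Cyc.pow_smul_eq_zero π h b
  · rintro rfl
    exact PowDvd.zero_right n

theorem Cyc.powDvd_smul_one {k n : ℕ} (h : n ≤ k) {r : R} :
    PowDvd π n (r • (1 : Cyc π k)) ↔ π ^ n ∣ r := by
  constructor
  · rintro ⟨b, hb⟩
    obtain ⟨s, rfl⟩ := Cyc.exists_smul_one π b
    rw [smul_smul, Cyc.smul_one_eq_iff] at hb
    have := (pow_dvd_pow π h).trans hb
    exact (dvd_sub_right (Dvd.intro _ rfl)).mp this
  · rintro ⟨s, rfl⟩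
    exact ⟨s • 1, by rw [smul_smul]⟩

open Classical in
/-- The valuation of an element of `R / π ^ k`; the valuation of `0` is `k`. -/
noncomputable def Cyc.val {k : ℕ} (a : Cyc π k) : ℕ := Nat.findGreatest (fun n => PowDvd π n a) k

theorem Cyc.val_le {k : ℕ} (a : Cyc π k) : a.val ≤ k := by
  classical exact Nat.findGreatest_le k

theorem Cyc.powDvd_val {k : ℕ} (a : Cyc π k) : PowDvd π a.val a := by
  classical
  exact Nat.findGreatest_spec (P := fun n => PowDvd π n a) (Nat.zero_le k) (PowDvd.zero_left a)

theorem Cyc.powDvd_iff {k n : ℕ} (hn : n ≤ k) {a : Cyc π k} : PowDvd π n a ↔ n ≤ a.val := by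
  classical
  exact ⟨fun h => Nat.le_findGreatest hn h, fun h => (Cyc.powDvd_val a).mono h⟩

/-- Only zero is divisible by `π ^ k` or more, so exponents beyond `k` act as `k`. -/
theorem Cyc.powDvd_iff_min {k n : ℕ} {a : Cyc π k} : PowDvd π n a ↔ min n k ≤ a.val := by
  rcases le_total n k with h | h
  · rw [Cyc.powDvd_iff h, min_eq_left h]
  · rw [min_eq_right h, ← Cyc.powDvd_iff le_rfl, Cyc.powDvd_eq_zero h, Cyc.powDvd_eq_zero le_rfl]

theorem Cyc.val_eq_iff {k : ℕ} {a : Cyc π k} : a.val = k ↔ a = 0 := by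
  rw [← Cyc.powDvd_eq_zero (le_refl k), Cyc.powDvd_iff le_rfl]
  have := a.val_le
  omega

theorem Cyc.val_zero {k : ℕ} : (0 : Cyc π k).val = k := Cyc.val_eq_iff.mpr rfl

/-- Multiplication by `π ^ e` as a homomorphism `R / π ^ k → R / π ^ l`. -/
def cycScale {k l : ℕ} (e : ℕ) (h : l ≤ k + e) : Cyc π k →ₗ[R] Cyc π l :=
  cycLift π k (π ^ e • 1) (by
    rw [smul_smul, ← pow_add]
    exact Cyc.pow_smul_eq_zero π h 1)

theorem cycScale_smul_one {k l e : ℕ} (h : l ≤ k + e) (r : R) :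
    cycScale (π := π) e h (r • 1) = (r * π ^ e) • 1 := by
  rw [map_smul, cycScale, cycLift_one, smul_smul]

end Cyclic

/-! ### Homomorphisms between cyclic modules over a discrete valuation ring, and cardinalities. -/

section DVR

variable {R : Type*} [CommRing R] [IsDomain R] {π : R}

theorem pow_dvd_pow_mul_iff (hπ : π ≠ 0) {k n : ℕ} {r : R} :
    π ^ k ∣ π ^ n * r ↔ π ^ (k - n) ∣ r := by
  rcases le_total k n with h | h
  · rw [Nat.sub_eq_zero_of_le h]
    simp [(pow_dvd_pow π h).mul_right r]
  · obtain ⟨m, rfl⟩ := Nat.exists_eq_add_of_le h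
    rw [Nat.add_sub_cancel_left, pow_add, mul_dvd_mul_iff_left (pow_ne_zero n hπ)]

theorem Cyc.powDvd_of_pow_smul_eq_zero (hπ : π ≠ 0) {k l : ℕ} {a : Cyc π l} (h : π ^ k • a = 0) :
    PowDvd π (l - k) a := by
  obtain ⟨r, rfl⟩ := Cyc.exists_smul_one π a
  rw [smul_smul, Cyc.smul_one_eq_zero, pow_dvd_pow_mul_iff hπ] at h
  exact (Cyc.powDvd_smul_one (Nat.sub_le l k)).mpr h

/-- The image of the generator is killed by `π ^ k`, hence a multiple of `π ^ (l - k)`; truncated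
subtraction covers `l ≤ k`. `Cyc.exists_hom` shows that there is no other constraint. -/
theorem Cyc.powDvd_hom (hπ : π ≠ 0) {k l : ℕ} (φ : Cyc π k →ₗ[R] Cyc π l) (a : Cyc π k) :
    PowDvd π (a.val + (l - k)) (φ a) := by
  obtain ⟨b, hb⟩ := a.powDvd_val
  obtain ⟨r, rfl⟩ := Cyc.exists_smul_one π b
  have h1 : PowDvd π (l - k) (φ 1) := Cyc.powDvd_of_pow_smul_eq_zero hπ (k := k) (by
    rw [← map_smul, Cyc.pow_smul_eq_zero π le_rfl, map_zero])
  have h2 : φ a = π ^ a.val • r • φ 1 := by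
    rw [← map_smul, ← map_smul, hb]
  rw [h2]
  exact (h1.smul r).pow_smul

theorem cycScale_injective (hπ : π ≠ 0) {k l e : ℕ} (h : l ≤ k + e) (h' : k ≤ l - e) :
    Function.Injective (cycScale (π := π) (k := k) e h) := by
  rw [injective_iff_map_eq_zero]
  intro a ha
  obtain ⟨r, rfl⟩ := Cyc.exists_smul_one π a
  rw [cycScale_smul_one, Cyc.smul_one_eq_zero, mul_comm, pow_dvd_pow_mul_iff hπ] at ha
  exact (Cyc.smul_one_eq_zero π).mpr ((pow_dvd_pow π h').trans ha)

theorem Cyc.val_pow_smul_one (hπ : Irreducible π) {k n : ℕ} (h : n ≤ k) :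
    (π ^ n • (1 : Cyc π k)).val = n := by
  apply le_antisymm
  · have := (π ^ n • (1 : Cyc π k)).powDvd_val
    rw [Cyc.powDvd_smul_one (Cyc.val_le _)] at this
    exact (pow_dvd_pow_iff hπ.ne_zero hπ.not_isUnit).mp this
  · rw [← Cyc.powDvd_iff h]
    exact ⟨1, rfl⟩

variable [IsDiscreteValuationRing R]

theorem Cyc.exists_unit_smul (hπ : Irreducible π) {k : ℕ} (a : Cyc π k) :
    ∃ u : Rˣ, a = ((u : R) * π ^ a.val) • (1 : Cyc π k) := by
  by_cases h0 : a = 0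
  · refine ⟨1, ?_⟩
    rw [mul_smul, Cyc.val_eq_iff.mpr h0, Cyc.pow_smul_eq_zero π le_rfl, smul_zero, h0]
  · obtain ⟨r, hr⟩ := Cyc.exists_smul_one π a
    have hr0 : r ≠ 0 := by
      rintro rfl
      exact h0 (by rw [hr, zero_smul])
    obtain ⟨n, u, hu⟩ := IsDiscreteValuationRing.eq_unit_mul_pow_irreducible hr0 hπ
    refine ⟨u, ?_⟩
    have hnk : n < k := by
      by_contra hn
      apply h0
      rw [hr, hu, mul_smul, Cyc.pow_smul_eq_zero π (not_lt.mp hn), smul_zero]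
    have hval : a.val = n := by
      apply le_antisymm
      · have h1 : π ^ a.val ∣ r := by
          rw [← Cyc.powDvd_smul_one (k := k) a.val_le, ← hr]
          exact a.powDvd_val
        rw [hu, Units.dvd_mul_left] at h1
        exact (pow_dvd_pow_iff hπ.ne_zero hπ.not_isUnit).mp h1
      · rw [← Cyc.powDvd_iff hnk.le, hr, Cyc.powDvd_smul_one hnk.le, hu]
        exact Dvd.intro_left _ rfl
    rw [hval, ← hu, ← hr]

theorem Cyc.exists_hom (hπ : Irreducible π) {k l : ℕ} (a : Cyc π k) {c : Cyc π l}
    (hc : PowDvd π (a.val + (l - k)) c) : ∃ φ : Cyc π k →ₗ[R] Cyc π l, φ a = c := by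
  obtain ⟨u, hu⟩ := a.exists_unit_smul hπ
  obtain ⟨b, rfl⟩ := hc
  refine ⟨cycLift π k ((π ^ (l - k) * ((u⁻¹ : Rˣ) : R)) • b) ?_, ?_⟩
  · rw [smul_smul, ← mul_assoc, ← pow_add, mul_comm, mul_smul,
      Cyc.pow_smul_eq_zero π (by omega), smul_zero]
  · conv_lhs => rw [hu]
    rw [map_smul, cycLift_one, smul_smul, pow_add]
    congr 1
    have := Units.mul_inv u
    linear_combination (π ^ a.val * π ^ (l - k)) * this

theorem Cyc.card (hπ : Irreducible π) (k : ℕ) :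
    Nat.card (Cyc π k) = Nat.card (IsLocalRing.ResidueField R) ^ k := by
  have h1 := hπ.maximalIdeal_eq
  have h2 : IsLocalRing.maximalIdeal R ≠ ⊥ := by
    rw [h1]
    simpa using hπ.ne_zero
  have h3 := cardQuot_pow_of_prime (P := IsLocalRing.maximalIdeal R) h2 (i := k)
  rw [Submodule.cardQuot_apply, Submodule.cardQuot_apply] at h3
  rw [IsLocalRing.ResidueField, ← h3]
  have h4 : IsLocalRing.maximalIdeal R ^ k = Ideal.span {π ^ k} := by
    rw [h1, Ideal.span_singleton_pow]
  rw [h4]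

theorem Cyc.finite [Finite (IsLocalRing.ResidueField R)] (hπ : Irreducible π) (k : ℕ) :
    Finite (Cyc π k) := by
  apply Nat.finite_of_card_ne_zero
  rw [Cyc.card hπ]
  exact pow_ne_zero _ Nat.card_pos.ne'

theorem Cyc.card_powDvd (hπ : Irreducible π) (k n : ℕ) :
    Nat.card {a : Cyc π k // PowDvd π n a} = Nat.card (IsLocalRing.ResidueField R) ^ (k - n) := by
  rw [← Cyc.card hπ]
  symm
  refine Nat.card_congr (Equiv.ofBijective
    (fun a => ⟨cycScale (π := π) (k := k - n) n (by omega) a, ?_⟩) ⟨?_, ?_⟩)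
  · obtain ⟨r, rfl⟩ := Cyc.exists_smul_one π a
    rw [cycScale_smul_one, mul_comm, mul_smul]
    exact ⟨_, rfl⟩
  · intro a b hab
    exact cycScale_injective hπ.ne_zero _ le_rfl (congrArg Subtype.val hab)
  · rintro ⟨_, b, rfl⟩
    obtain ⟨r, rfl⟩ := Cyc.exists_smul_one π b
    refine ⟨r • 1, Subtype.ext ?_⟩
    simp only
    rw [cycScale_smul_one, mul_comm, mul_smul]

end DVR

/-! ### Homomorphisms from products of cyclic modules. -/

section Product

variable {R : Type*} [CommRing R] (π : R) {ι : Type*} [Fintype ι] [DecidableEq ι]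

/-- The product of the cyclic modules `R / π ^ (l i)`. -/
abbrev CycProd {ι : Type*} (l : ι → ℕ) := ∀ i, Cyc π (l i)

variable {M : Type*} [AddCommGroup M] [Module R M] {l : ι → ℕ}

/-- The homomorphism which maps the generators to given elements. -/
def prodLift (m : ι → M) (hm : ∀ i, π ^ l i • m i = 0) : CycProd π l →ₗ[R] M :=
  ∑ i, (cycLift π (l i) (m i) (hm i)) ∘ₗ LinearMap.proj i

theorem prodLift_single (m : ι → M) (hm : ∀ i, π ^ l i • m i = 0) (i : ι) :
    prodLift π m hm (Pi.single i 1) = m i := by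
  rw [prodLift, LinearMap.sum_apply, Finset.sum_eq_single i]
  · simp [cycLift_one]
  · intro j _ hj
    simp [hj]
  · simp

theorem CycProd.hom_ext {φ ψ : CycProd π l →ₗ[R] M}
    (h : ∀ i, φ (Pi.single i 1) = ψ (Pi.single i 1)) : φ = ψ := by
  refine LinearMap.pi_ext' fun i => Cyc.hom_ext π ?_
  simpa using h i

/-- The minimal valuation of the image of an element with coordinates of valuations `t` under
a homomorphism to the cyclic module of length `m`. -/
noncomputable def homVal {ι : Type*} (l t : ι → ℕ) (m : ℕ) : ℕ :=
  -- Inserting `m`, the valuation of zero, caps the minimum and keeps the set non-empty when there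
  -- are no coordinates.
  sInf (insert m (Set.range fun k => t k + (m - l k)))

theorem homVal_le {ι : Type*} (l t : ι → ℕ) (m : ℕ) : homVal l t m ≤ m :=
  Nat.sInf_le (Set.mem_insert _ _)

theorem homVal_le_add {ι : Type*} (l t : ι → ℕ) (m : ℕ) (k : ι) :
    homVal l t m ≤ t k + (m - l k) :=
  Nat.sInf_le (Set.mem_insert_of_mem _ ⟨k, rfl⟩)

theorem homVal_eq_or {ι : Type*} (l t : ι → ℕ) (m : ℕ) :
    homVal l t m = m ∨ ∃ k, homVal l t m = t k + (m - l k) := by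
  have h : homVal l t m ∈ insert m (Set.range fun k => t k + (m - l k)) :=
    Nat.sInf_mem (Set.insert_nonempty _ _)
  rcases h with h | ⟨k, hk⟩
  · exact Or.inl h
  · exact Or.inr ⟨k, hk.symm⟩

variable [IsDomain R] {π}

theorem CycProd.powDvd_hom (hπ : π ≠ 0) {m : ℕ} (φ : CycProd π l →ₗ[R] Cyc π m)
    (a : CycProd π l) : PowDvd π (homVal l (fun i => (a i).val) m) (φ a) := by
  have h : φ a = ∑ i, φ (Pi.single i (a i)) := by
    rw [← map_sum, Finset.univ_sum_single]
  rw [h]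
  refine PowDvd.sum _ _ fun i _ => ?_
  exact (Cyc.powDvd_hom hπ (φ ∘ₗ LinearMap.single R (fun i => Cyc π (l i)) i) (a i)).mono (homVal_le_add l (fun i => (a i).val) m i)

end Product

theorem CycProd.exists_hom {R : Type*} [CommRing R] [IsDomain R] [IsDiscreteValuationRing R] {π : R}
    {ι : Type*} {l : ι → ℕ} (hπ : Irreducible π) {m : ℕ}
    (a : CycProd π l) {c : Cyc π m} (hc : PowDvd π (homVal l (fun i => (a i).val) m) c) :
    ∃ φ : CycProd π l →ₗ[R] Cyc π m, φ a = c := by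
  rcases homVal_eq_or l (fun i => (a i).val) m with h | ⟨k, hk⟩
  · rw [h, Cyc.powDvd_eq_zero le_rfl] at hc
    exact ⟨0, hc.symm⟩
  · rw [hk] at hc
    obtain ⟨φ, hφ⟩ := Cyc.exists_hom hπ (a k) hc
    exact ⟨φ ∘ₗ LinearMap.proj k, hφ⟩

/-! ### The quotient by the cyclic submodule generated by `e`. -/

section Antichain

/-- A set of indices with exponents `v i < l i`, such that the pairs `(v i, l i)` form an antichain
of the fundamental poset. -/
structure AntichainData (ι : Type*) (l : ι → ℕ) where
  S : Finset ι
  v : ι → ℕ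
  v_lt : ∀ i ∈ S, v i < l i
  eq_of_eq : ∀ i ∈ S, ∀ j ∈ S, l i = l j → i = j
  lt_of_lt : ∀ i ∈ S, ∀ j ∈ S, l i < l j → v i < v j ∧ l i - v i < l j - v j

variable {ι : Type*} [DecidableEq ι] {l : ι → ℕ} (C : AntichainData ι l)

namespace AntichainData

/-- The element `∑ π ^ (v i)` of the product of cyclic modules. -/
def elem {R : Type*} [CommRing R] (π : R) : CycProd π l :=
  fun i => if i ∈ C.S then π ^ C.v i • 1 else 0

/-- The exponents of the quotient of the product of cyclic modules by the cyclic submodule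
generated by `C.elem`. -/
def nu (i : ι) : ℕ :=
  if i ∈ C.S then C.v i + (C.S.filter (l · < l i)).sup (fun j => l j - C.v j) else l i

/-- `p` is the predecessor of `i` in the set of indices, ordered by `l`. -/
def IsPred (p i : ι) : Prop := p ∈ C.S ∧ l p < l i ∧ ∀ j ∈ C.S, l j < l i → l j ≤ l p

theorem nu_of_notMem {i : ι} (hi : i ∉ C.S) : C.nu i = l i := if_neg hi

/-- Along an antichain `l - v` increases with `l`, so the supremum in `nu` is attained at the
predecessor. -/
theorem nu_of_isPred {p i : ι} (hi : i ∈ C.S) (hp : C.IsPred p i) :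
    C.nu i = C.v i + (l p - C.v p) := by
  rw [nu, if_pos hi]
  congr 1
  apply le_antisymm
  · refine Finset.sup_le fun j hj => ?_
    rw [Finset.mem_filter] at hj
    rcases (hp.2.2 j hj.1 hj.2).eq_or_lt with h | h
    · rw [C.eq_of_eq j hj.1 p hp.1 h]
    · exact (C.lt_of_lt j hj.1 p hp.1 h).2.le
  · exact Finset.le_sup (f := fun j => l j - C.v j) (Finset.mem_filter.mpr ⟨hp.1, hp.2.1⟩)

theorem nu_of_min {i : ι} (hi : i ∈ C.S) (hmin : ∀ j ∈ C.S, l i ≤ l j) : C.nu i = C.v i := by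
  rw [nu, if_pos hi, Finset.filter_eq_empty_iff.mpr fun j hj => not_lt.mpr (hmin j hj)]
  simp

omit [DecidableEq ι] in
theorem isPred_unique {p p' i : ι} (hp : C.IsPred p i) (hp' : C.IsPred p' i) : p = p' :=
  C.eq_of_eq p hp.1 p' hp'.1 (le_antisymm (hp'.2.2 p hp.1 hp.2.1) (hp.2.2 p' hp'.1 hp'.2.1))

omit [DecidableEq ι] in
theorem min_or_exists_isPred (i : ι) : (∀ j ∈ C.S, l i ≤ l j) ∨ ∃ p, C.IsPred p i := by
  rcases (C.S.filter (l · < l i)).eq_empty_or_nonempty with h | h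
  · left
    intro j hj
    exact not_lt.mp (Finset.filter_eq_empty_iff.mp h hj)
  · right
    obtain ⟨p, hp, hmax⟩ := Finset.exists_max_image _ l h
    rw [Finset.mem_filter] at hp
    exact ⟨p, hp.1, hp.2, fun j hj hji => hmax j (Finset.mem_filter.mpr ⟨hj, hji⟩)⟩

theorem nu_le (i : ι) : C.nu i ≤ l i := by
  by_cases hi : i ∈ C.S
  · have h0 := C.v_lt i hi
    rcases C.min_or_exists_isPred i with h | ⟨p, hp⟩
    · rw [C.nu_of_min hi h]
      exact h0.le
    · rw [C.nu_of_isPred hi hp]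
      have := (C.lt_of_lt p hp.1 i hi hp.2.1).2
      omega
  · rw [C.nu_of_notMem hi]

variable {R : Type*} [CommRing R] {π : R}

open Classical in
/-- The contribution of the predecessor to the quotient map. -/
noncomputable def predHom (i : ι) : CycProd π l →ₗ[R] Cyc π (C.nu i) :=
  if h : i ∈ C.S ∧ ∃ p, C.IsPred p i then
    cycScale (C.v i - C.v h.2.choose) (by
      -- The target has exponent exactly `l p + (v i - v p)`, so this multiplication is well
      -- defined.
      have hp := h.2.choose_spec
      have h1 := (C.lt_of_lt _ hp.1 i h.1 hp.2.1).1
      have h2 := C.v_lt _ hp.1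
      rw [C.nu_of_isPred h.1 hp]
      omega) ∘ₗ LinearMap.proj h.2.choose
  else 0

theorem predHom_of_notMem {i : ι} (hi : i ∉ C.S) (y : CycProd π l) : C.predHom i y = 0 := by
  rw [predHom, dif_neg (fun h => hi h.1), LinearMap.zero_apply]

theorem predHom_of_min {i : ι} (hmin : ∀ j ∈ C.S, l i ≤ l j) (y : CycProd π l) :
    C.predHom i y = 0 := by
  rw [predHom, dif_neg, LinearMap.zero_apply]
  rintro ⟨_, p, hp⟩
  exact (hmin p hp.1).not_gt hp.2.1

theorem predHom_of_isPred {p i : ι} (hi : i ∈ C.S) (hp : C.IsPred p i) {y : CycProd π l} {r : R}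
    (hy : y p = r • 1) : C.predHom i y = (r * π ^ (C.v i - C.v p)) • 1 := by
  have h : i ∈ C.S ∧ ∃ p, C.IsPred p i := ⟨hi, p, hp⟩
  have hc := C.isPred_unique h.2.choose_spec hp
  rw [predHom, dif_pos h, LinearMap.comp_apply]
  change cycScale _ _ (y h.2.choose) = _
  rw [show y h.2.choose = r • 1 by rw [hc, hy], cycScale_smul_one, hc]

/-- The quotient map by the cyclic submodule generated by `C.elem`. -/
noncomputable def quotMap : CycProd π l →ₗ[R] CycProd π C.nu :=
  LinearMap.pi fun i => cycScale 0 (C.nu_le i) ∘ₗ LinearMap.proj i - C.predHom i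

theorem quotMap_apply (y : CycProd π l) (i : ι) :
    C.quotMap y i = cycScale 0 (C.nu_le i) (y i) - C.predHom i y := rfl

theorem quotMap_of_min {i : ι} (hmin : ∀ j ∈ C.S, l i ≤ l j) {y : CycProd π l}
    {r : R} (hy : y i = r • 1) : C.quotMap y i = r • 1 := by
  rw [quotMap_apply, C.predHom_of_min hmin, hy, cycScale_smul_one, pow_zero, mul_one, sub_zero]

theorem quotMap_of_notMem {i : ι} (hi : i ∉ C.S) {y : CycProd π l}
    {r : R} (hy : y i = r • 1) : C.quotMap y i = r • 1 := by
  rw [quotMap_apply, C.predHom_of_notMem hi, hy, cycScale_smul_one, pow_zero, mul_one, sub_zero]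

theorem quotMap_of_isPred {p i : ι} (hi : i ∈ C.S) (hp : C.IsPred p i) {y : CycProd π l} {r s : R}
    (hy : y i = r • 1) (hy' : y p = s • 1) :
    C.quotMap y i = (r - s * π ^ (C.v i - C.v p)) • 1 := by
  rw [quotMap_apply, C.predHom_of_isPred hi hp hy', hy, cycScale_smul_one, pow_zero, mul_one,
    sub_smul]

theorem quotMap_congr {i : ι} (hi : i ∈ C.S) {y y' : CycProd π l} (h : ∀ j ∈ C.S, y j = y' j) :
    C.quotMap y i = C.quotMap y' i := by
  obtain ⟨r, hr⟩ := Cyc.exists_smul_one π (y i)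
  rcases C.min_or_exists_isPred i with hm | ⟨p, hp⟩
  · rw [C.quotMap_of_min hm hr, C.quotMap_of_min hm ((h i hi).symm.trans hr)]
  · obtain ⟨s, hs⟩ := Cyc.exists_smul_one π (y p)
    rw [C.quotMap_of_isPred hi hp hr hs, C.quotMap_of_isPred hi hp ((h i hi).symm.trans hr)
      ((h p hp.1).symm.trans hs)]

theorem quotMap_elem : C.quotMap (C.elem π) = 0 := by
  funext i
  by_cases hi : i ∈ C.S
  · have he (j : ι) (hj : j ∈ C.S) : C.elem π j = π ^ C.v j • 1 := if_pos hj
    rcases C.min_or_exists_isPred i with hm | ⟨p, hp⟩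
    · rw [C.quotMap_of_min hm (he i hi), Pi.zero_apply]
      exact Cyc.pow_smul_eq_zero π (C.nu_of_min hi hm).le _
    · rw [C.quotMap_of_isPred hi hp (he i hi) (he p hp.1), ← pow_add,
        Nat.add_sub_cancel' (C.lt_of_lt p hp.1 i hi hp.2.1).1.le, sub_self, zero_smul, Pi.zero_apply]
  · have he : C.elem π i = (0 : R) • 1 := by
      rw [zero_smul]
      exact if_neg hi
    rw [C.quotMap_of_notMem hi he, zero_smul, Pi.zero_apply]

theorem quotMap_surjective : Function.Surjective (C.quotMap (π := π)) := by
  intro b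
  choose s hs using fun i => Cyc.exists_smul_one π (b i)
  -- The equations `Y i - π ^ (v i - v p) * Y p = s i` are solved by unrolling them along the chain
  -- of predecessors.
  let Y (i : ι) : R := if i ∈ C.S then
    ∑ j ∈ C.S.filter (l · ≤ l i), π ^ (C.v i - C.v j) * s j else s i
  refine ⟨fun i => Y i • 1, funext fun i => ?_⟩
  rw [hs i]
  by_cases hi : i ∈ C.S
  · have h1 : C.S.filter (l · ≤ l i) = insert i (C.S.filter (l · < l i)) := by
      ext j
      simp only [Finset.mem_filter, Finset.mem_insert]
      constructor
      · rintro ⟨hj, hji⟩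
        rcases hji.eq_or_lt with h | h
        · exact Or.inl (C.eq_of_eq j hj i hi h)
        · exact Or.inr ⟨hj, h⟩
      · rintro (rfl | ⟨hj, h⟩)
        · exact ⟨hi, le_rfl⟩
        · exact ⟨hj, h.le⟩
    have h2 : Y i = s i + ∑ j ∈ C.S.filter (l · < l i), π ^ (C.v i - C.v j) * s j := by
      simp only [Y, if_pos hi]
      rw [h1, Finset.sum_insert (by simp)]
      simp
    rcases C.min_or_exists_isPred i with hm | ⟨p, hp⟩
    · rw [C.quotMap_of_min hm rfl, h2,
        Finset.filter_eq_empty_iff.mpr fun j hj => not_lt.mpr (hm j hj)]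
      simp
    · rw [C.quotMap_of_isPred hi hp rfl rfl]
      congr 1
      have h3 : C.S.filter (l · < l i) = C.S.filter (l · ≤ l p) := by
        ext j
        simp only [Finset.mem_filter]
        exact ⟨fun h => ⟨h.1, hp.2.2 j h.1 h.2⟩, fun h => ⟨h.1, h.2.trans_lt hp.2.1⟩⟩
      rw [h2, h3]
      simp only [Y, if_pos hp.1]
      rw [Finset.sum_mul, add_sub_assoc, ← Finset.sum_sub_distrib, Finset.sum_eq_zero, add_zero]
      intro j hj
      rw [Finset.mem_filter] at hj
      have h4 : C.v j ≤ C.v p := by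
        rcases hj.2.eq_or_lt with h | h
        · rw [C.eq_of_eq j hj.1 p hp.1 h]
        · exact (C.lt_of_lt j hj.1 p hp.1 h).1.le
      have h5 := (C.lt_of_lt p hp.1 i hi hp.2.1).1
      rw [show C.v i - C.v j = (C.v p - C.v j) + (C.v i - C.v p) by omega, pow_add]
      ring
  · rw [C.quotMap_of_notMem hi rfl]
    simp only [Y, if_neg hi]

/-- On the support `Y i = π ^ v i * Z i`, and `Z i` agrees with `Z p` modulo `π ^ (l p - v p)` for
the predecessor `p`. These moduli grow along the chain, so `Z` at the longest index of the support
agrees with every `Z j` to the precision that coordinate `j` sees. -/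
theorem exists_eq_smul_elem [IsDomain R] (hπ : π ≠ 0) {y : CycProd π l} (hy : C.quotMap y = 0) :
    ∃ r : R, y = r • C.elem π := by
  choose Y hY using fun i => Cyc.exists_smul_one π (y i)
  have hpred (p i : ι) (hi : i ∈ C.S) (hp : C.IsPred p i) :
      π ^ (C.v i + (l p - C.v p)) ∣ Y i - Y p * π ^ (C.v i - C.v p) := by
    have := congrFun hy i
    rwa [C.quotMap_of_isPred hi hp (hY i) (hY p), Pi.zero_apply, Cyc.smul_one_eq_zero,
      C.nu_of_isPred hi hp] at this
  have hdvd (n : ℕ) : ∀ i ∈ C.S, l i = n → π ^ C.v i ∣ Y i := by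
    induction n using Nat.strong_induction_on with
    | _ n ih =>
      intro i hi hin
      rcases C.min_or_exists_isPred i with hm | ⟨p, hp⟩
      · have := congrFun hy i
        rwa [C.quotMap_of_min hm (hY i), Pi.zero_apply, Cyc.smul_one_eq_zero,
          C.nu_of_min hi hm] at this
      · have h1 := ih (l p) (hin ▸ hp.2.1) p hp.1 rfl
        have h2 : π ^ C.v i ∣ Y p * π ^ (C.v i - C.v p) := by
          rw [← Nat.add_sub_cancel' (C.lt_of_lt p hp.1 i hi hp.2.1).1.le, pow_add,
            Nat.add_sub_cancel_left]
          exact mul_dvd_mul_right h1 _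
        exact (dvd_sub_left h2).mp ((pow_dvd_pow π (Nat.le_add_right _ _)).trans (hpred p i hi hp))
  have hZ' (i : ι) : ∃ z, i ∈ C.S → Y i = π ^ C.v i * z := by
    by_cases hi : i ∈ C.S
    · obtain ⟨z, hz⟩ := hdvd _ i hi rfl
      exact ⟨z, fun _ => hz⟩
    · exact ⟨0, fun h => absurd h hi⟩
  choose Z hZ using hZ'
  have hpredZ (p i : ι) (hi : i ∈ C.S) (hp : C.IsPred p i) : π ^ (l p - C.v p) ∣ Z i - Z p := by
    have h1 := hpred p i hi hp
    have h2 : π ^ C.v i = π ^ C.v p * π ^ (C.v i - C.v p) := by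
      rw [← pow_add, Nat.add_sub_cancel' (C.lt_of_lt p hp.1 i hi hp.2.1).1.le]
    rw [hZ i hi, hZ p hp.1, pow_add,
      show π ^ C.v i * Z i - π ^ C.v p * Z p * π ^ (C.v i - C.v p) = π ^ C.v i * (Z i - Z p) by
        rw [h2]; ring] at h1
    exact (mul_dvd_mul_iff_left (pow_ne_zero _ hπ)).mp h1
  have hall (n : ℕ) : ∀ i ∈ C.S, l i = n → ∀ j ∈ C.S, l j < l i →
      π ^ (l j - C.v j) ∣ Z i - Z j := by
    induction n using Nat.strong_induction_on with
    | _ n ih =>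
      intro i hi hin j hj hji
      rcases C.min_or_exists_isPred i with hm | ⟨p, hp⟩
      · exact absurd hji (not_lt.mpr (hm j hj))
      · have h1 := hpredZ p i hi hp
        rcases (hp.2.2 j hj hji).eq_or_lt with h | h
        · rwa [C.eq_of_eq j hj p hp.1 h]
        · have h2 := ih (l p) (hin ▸ hp.2.1) p hp.1 rfl j hj h
          have h3 := (pow_dvd_pow π (C.lt_of_lt j hj p hp.1 h).2.le).trans h1
          simpa using dvd_add h3 h2
  have hr : ∃ r, ∀ j ∈ C.S, π ^ (l j - C.v j) ∣ r - Z j := by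
    rcases C.S.eq_empty_or_nonempty with h | h
    · exact ⟨0, by simp [h]⟩
    · obtain ⟨s, hs, hmax⟩ := Finset.exists_max_image _ l h
      refine ⟨Z s, fun j hj => ?_⟩
      rcases (hmax j hj).eq_or_lt with h | h
      · rw [C.eq_of_eq j hj s hs h, sub_self]
        exact dvd_zero _
      · exact hall _ s hs rfl j hj h
  obtain ⟨r, hr⟩ := hr
  refine ⟨r, funext fun i => ?_⟩
  rw [Pi.smul_apply]
  by_cases hi : i ∈ C.S
  · rw [hY i, elem, if_pos hi, smul_smul, Cyc.smul_one_eq_iff, hZ i hi, dvd_sub_comm,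
      show r * π ^ C.v i - π ^ C.v i * Z i = π ^ C.v i * (r - Z i) by ring,
      pow_dvd_pow_mul_iff hπ]
    exact hr i hi
  · have := congrFun hy i
    rw [C.quotMap_of_notMem hi (hY i), Pi.zero_apply, Cyc.smul_one_eq_zero,
      C.nu_of_notMem hi] at this
    rw [elem, if_neg hi, smul_zero, hY i, Cyc.smul_one_eq_zero]
    exact this

theorem val_quotMap_of_notMem {i : ι} (hi : i ∉ C.S) (y : CycProd π l) :
    (C.quotMap y i).val = (y i).val := by
  have key : ∀ {k m : ℕ} (r : R), k = m → (r • (1 : Cyc π k)).val = (r • (1 : Cyc π m)).val := by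
    rintro k m r rfl
    rfl
  obtain ⟨r, hr⟩ := Cyc.exists_smul_one π (y i)
  rw [C.quotMap_of_notMem hi hr, hr]
  exact key r (C.nu_of_notMem hi)

end AntichainData

end Antichain
-- Endomorphisms killing `e` and the orbits of its stabilizer.
theorem exists_comp_eq_of_ker_le {R M N P : Type*} [CommRing R] [AddCommGroup M] [AddCommGroup N]
    [AddCommGroup P] [Module R M] [Module R N] [Module R P] {q : M →ₗ[R] N}
    (hq : Function.Surjective q) {φ : M →ₗ[R] P} (h : LinearMap.ker q ≤ LinearMap.ker φ) :
    ∃ ψ : N →ₗ[R] P, ψ ∘ₗ q = φ := by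
  refine ⟨(LinearMap.ker q).liftQ φ h ∘ₗ (q.quotKerEquivOfSurjective hq).symm.toLinearMap,
    LinearMap.ext fun y => ?_⟩
  have h1 : (q.quotKerEquivOfSurjective hq).symm (q y) = Submodule.Quotient.mk y := by
    rw [LinearEquiv.symm_apply_eq]
    rfl
  rw [LinearMap.comp_apply, LinearMap.comp_apply, LinearEquiv.coe_coe, h1]
  exact Submodule.liftQ_apply _ _ _

section DVR

variable {R : Type*} [CommRing R] [IsDomain R] {π : R}

theorem PowDvd.cyc_hom (hπ : π ≠ 0) {n k m : ℕ} {a : Cyc π k} (ha : PowDvd π n a)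
    (φ : Cyc π k →ₗ[R] Cyc π m) : PowDvd π (n + (m - k)) (φ a) := by
  obtain ⟨b, rfl⟩ := ha
  rw [map_smul]
  exact ((Cyc.powDvd_hom hπ φ b).mono (Nat.le_add_left _ _)).pow_smul

end DVR

namespace AntichainData

variable {ι : Type*} [Fintype ι] [DecidableEq ι] {l : ι → ℕ} (C : AntichainData ι l)
variable {R : Type*} [CommRing R] {π : R}

/-- The valuations of the coordinates of the image of an element in the quotient. -/
noncomputable def typ (y : CycProd π l) (i : ι) : ℕ := (C.quotMap y i).val

/-- The exponents of the submodule of all images of an element under the endomorphisms which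
annihilate `C.elem`, as a function of the type of the element. -/
noncomputable def cvec (t : ι → ℕ) (i : ι) : ℕ := homVal C.nu t (l i)

omit [Fintype ι] in
theorem cvec_le (t : ι → ℕ) (i : ι) : C.cvec t i ≤ l i := homVal_le _ _ _

section Domain

variable [IsDomain R]

/-- A homomorphism killing `e` factors through `quotMap`, whose kernel is `Re`, so the bound for
products applies to the image of `y`. -/
theorem powDvd_hom (hπ : π ≠ 0) {m : ℕ} {φ : CycProd π l →ₗ[R] Cyc π m}
    (hφ : φ (C.elem π) = 0) (y : CycProd π l) : PowDvd π (homVal C.nu (C.typ y) m) (φ y) := by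
  have hker : LinearMap.ker (C.quotMap (π := π)) ≤ LinearMap.ker φ := by
    intro z hz
    obtain ⟨r, rfl⟩ := C.exists_eq_smul_elem hπ hz
    rw [LinearMap.mem_ker, map_smul, hφ, smul_zero]
  obtain ⟨ψ, rfl⟩ := exists_comp_eq_of_ker_le C.quotMap_surjective hker
  exact CycProd.powDvd_hom hπ ψ _

theorem powDvd_end (hπ : π ≠ 0) {n : CycProd π l →ₗ[R] CycProd π l}
    (hn : n (C.elem π) = 0) (y : CycProd π l) (i : ι) :
    PowDvd π (C.cvec (C.typ y) i) (n y i) :=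
  C.powDvd_hom hπ (m := l i) (φ := LinearMap.proj (φ := fun i => Cyc π (l i)) i ∘ₗ n) (by
    rw [LinearMap.comp_apply, hn, map_zero]) y

end Domain

section Nilpotent

variable [IsDomain R]

/-- The elements supported on the index set, of weight at least `k`; the weight of an element of
valuation `e` in the coordinate `i` is `2 * e - l i`, up to a constant. -/
def WeightGe (L k : ℕ) (a : CycProd π l) : Prop :=
  (∀ i ∉ C.S, a i = 0) ∧ ∀ i ∈ C.S, ∀ e, 2 * e + L ≤ k + l i + 1 → PowDvd π e (a i)

/-- The projection to the coordinates in the index set. -/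
def projS : CycProd π l →ₗ[R] CycProd π l :=
  LinearMap.pi fun i => if i ∈ C.S then LinearMap.proj i else 0

omit [Fintype ι] [IsDomain R] in
theorem projS_of_mem {i : ι} (hi : i ∈ C.S) (a : CycProd π l) : C.projS a i = a i := by
  simp [projS, hi]

omit [Fintype ι] [IsDomain R] in
theorem projS_of_notMem {i : ι} (hi : i ∉ C.S) (a : CycProd π l) : C.projS a i = 0 := by
  simp [projS, hi]

/-- In coordinate `i` of `n e = 0`, the antichain inequalities make every off-diagonal term
divisible by `π ^ (v i + 1)`. Hence so is the diagonal term `π ^ v i * r`, and since `v i < l i`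
this gives `π ∣ r`. -/
theorem powDvd_one_diag (hπ : π ≠ 0) {n : CycProd π l →ₗ[R] CycProd π l}
    (hn : n (C.elem π) = 0) {i : ι} (hi : i ∈ C.S) (b : Cyc π (l i)) :
    PowDvd π 1 (n (Pi.single i b) i) := by
  have hvi := C.v_lt i hi
  have h1 : ∑ j, n (Pi.single j (C.elem π j)) i = 0 := by
    rw [← Finset.sum_apply, ← map_sum, Finset.univ_sum_single, hn, Pi.zero_apply]
  rw [← Finset.add_sum_erase _ _ (Finset.mem_univ i)] at h1
  have h2 : PowDvd π (C.v i + 1) (∑ j ∈ Finset.univ.erase i, n (Pi.single j (C.elem π j)) i) := by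
    refine PowDvd.sum _ _ fun j hj => ?_
    have hji := Finset.ne_of_mem_erase hj
    by_cases hjS : j ∈ C.S
    · have h3 : PowDvd π (C.v j) (C.elem π j) := by
        rw [elem, if_pos hjS]
        exact ⟨1, rfl⟩
      have h4 := h3.cyc_hom hπ
        (LinearMap.proj i ∘ₗ n ∘ₗ LinearMap.single R (fun i => Cyc π (l i)) j)
      refine h4.mono ?_
      rcases lt_trichotomy (l i) (l j) with h | h | h
      · have := C.lt_of_lt i hi j hjS h
        omega
      · exact absurd (C.eq_of_eq i hi j hjS h).symm hji
      · have := C.lt_of_lt j hjS i hi h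
        have := C.v_lt j hjS
        omega
    · rw [elem, if_neg hjS, Pi.single_zero, map_zero, Pi.zero_apply]
      exact PowDvd.zero_right _
  have h3 : PowDvd π (C.v i + 1) (n (Pi.single i (C.elem π i)) i) := by
    rw [eq_neg_of_add_eq_zero_left h1]
    exact h2.neg
  obtain ⟨r, hr⟩ := Cyc.exists_smul_one π (n (Pi.single i 1) i)
  have h4 : n (Pi.single i (C.elem π i)) i = (π ^ C.v i * r) • 1 := by
    rw [elem, if_pos hi, Pi.single_smul, map_smul, Pi.smul_apply, hr, smul_smul]
  have hvi' : C.v i + 1 ≤ l i := hvi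
  rw [h4, Cyc.powDvd_smul_one hvi', pow_dvd_pow_mul_iff hπ,
    Nat.add_sub_cancel_left] at h3
  obtain ⟨s, rfl⟩ := Cyc.exists_smul_one π b
  rw [Pi.single_smul, map_smul, Pi.smul_apply, hr, smul_smul,
    Cyc.powDvd_smul_one (by omega)]
  exact h3.mul_left s

/-- A homomorphism between parts of different lengths raises the weight `2 * e - l i` by at least
the difference of the lengths, in either direction. Within the support equal lengths mean equal
indices, where `powDvd_one_diag` gains a factor `π`. -/
theorem weightGe_succ (hπ : π ≠ 0) {n : CycProd π l →ₗ[R] CycProd π l}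
    (hn : n (C.elem π) = 0) {L k : ℕ} {a : CycProd π l} (ha : C.WeightGe L k a) :
    C.WeightGe L (k + 1) (C.projS (n a)) := by
  refine ⟨fun i hi => C.projS_of_notMem hi _, fun i hi e he => ?_⟩
  rw [C.projS_of_mem hi]
  have h1 : n a i = ∑ j, n (Pi.single j (a j)) i := by
    rw [← Finset.sum_apply, ← map_sum, Finset.univ_sum_single]
  rw [h1]
  refine PowDvd.sum _ _ fun j _ => ?_
  by_cases hj : j ∈ C.S
  · have key (e' : ℕ) (h : PowDvd π e' (a j)) :
        PowDvd π (e' + (l i - l j)) (n (Pi.single j (a j)) i) :=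
      h.cyc_hom hπ (LinearMap.proj i ∘ₗ n ∘ₗ LinearMap.single R (fun i => Cyc π (l i)) j)
    rcases lt_trichotomy (l i) (l j) with h | h | h
    · exact (key e (ha.2 j hj e (by omega))).mono (Nat.le_add_right _ _)
    · obtain rfl := C.eq_of_eq i hi j hj h
      rcases Nat.eq_zero_or_pos e with rfl | hpos
      · exact PowDvd.zero_left _
      · obtain ⟨b, hb⟩ := ha.2 i hi (e - 1) (by omega)
        rw [← hb, Pi.single_smul, map_smul, Pi.smul_apply]
        have := (C.powDvd_one_diag hπ hn hi b).pow_smul (m := e - 1)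
        rwa [Nat.sub_add_cancel hpos] at this
    · rcases le_total e (l i - l j) with h' | h'
      · exact (key 0 (PowDvd.zero_left _)).mono (by omega)
      · exact (key (e - (l i - l j)) (ha.2 j hj _ (by omega))).mono (by omega)
  · rw [ha.1 j hj, Pi.single_zero, map_zero, Pi.zero_apply]
    exact PowDvd.zero_right _

theorem isNilpotent_projS_comp (hπ : π ≠ 0) {n : CycProd π l →ₗ[R] CycProd π l}
    (hn : n (C.elem π) = 0) : IsNilpotent (C.projS ∘ₗ n : Module.End R (CycProd π l)) := by
  -- `L` bounds every `l i`: at `k = 0` the weight condition is automatic, and at `k = 2 * L` it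
  -- forces `π ^ l i` to divide coordinate `i`.
  let L := ∑ i, l i
  have hL (i : ι) : l i ≤ L := Finset.single_le_sum (f := l) (fun _ _ => Nat.zero_le _)
    (Finset.mem_univ i)
  have h (k : ℕ) (a : CycProd π l) :
      C.WeightGe L k (((C.projS ∘ₗ n : Module.End R (CycProd π l)) ^ (k + 1)) a) := by
    induction k with
    | zero =>
      rw [pow_one]
      refine ⟨fun i hi => C.projS_of_notMem hi _, fun i _ e he => ?_⟩
      have := hL i
      obtain rfl : e = 0 := by omega
      exact PowDvd.zero_left _
    | succ k ih =>
      rw [pow_succ']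
      exact C.weightGe_succ hπ hn ih
  refine ⟨2 * L + 1, LinearMap.ext fun a => funext fun i => ?_⟩
  have := h (2 * L) a
  by_cases hi : i ∈ C.S
  · exact (Cyc.powDvd_eq_zero le_rfl).mp (this.2 i hi (l i) (by have := hL i; omega))
  · exact this.1 i hi

end Nilpotent

section Stabilizer

/-- Two elements are related by an automorphism which fixes `C.elem`. -/
def StabRel (y y' : CycProd π l) : Prop :=
  ∃ h : CycProd π l ≃ₗ[R] CycProd π l, h (C.elem π) = C.elem π ∧ h y = y'

variable {C} in
omit [Fintype ι] in
theorem StabRel.symm {y y' : CycProd π l} (h : C.StabRel y y') : C.StabRel y' y := by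
  obtain ⟨h, hx, rfl⟩ := h
  exact ⟨h.symm, by rw [LinearEquiv.symm_apply_eq, hx], h.symm_apply_apply y⟩

variable [IsDomain R] [IsDiscreteValuationRing R] (hπ : Irreducible π)

include hπ

omit [Fintype ι] in
theorem exists_hom {m : ℕ} (y : CycProd π l) {c : Cyc π m}
    (hc : PowDvd π (homVal C.nu (C.typ y) m) c) :
    ∃ φ : CycProd π l →ₗ[R] Cyc π m, φ (C.elem π) = 0 ∧ φ y = c := by
  obtain ⟨φ, hφ⟩ := CycProd.exists_hom hπ (C.quotMap y) hc
  exact ⟨φ ∘ₗ C.quotMap, by rw [LinearMap.comp_apply, C.quotMap_elem, map_zero], hφ⟩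

omit [Fintype ι] in
theorem exists_end (y : CycProd π l) {a : CycProd π l}
    (ha : ∀ i, PowDvd π (C.cvec (C.typ y) i) (a i)) :
    ∃ n : CycProd π l →ₗ[R] CycProd π l, n (C.elem π) = 0 ∧ n y = a := by
  choose φ hφ using fun i => C.exists_hom hπ y (ha i)
  exact ⟨LinearMap.pi φ, funext fun i => (hφ i).1, funext fun i => (hφ i).2⟩

/-- Composition with an automorphism fixing `e` preserves the homomorphisms that kill `e`, so it
suffices to transport one whose value at `y` has the least valuation. -/
theorem StabRel.cvec_le {y y' : CycProd π l} (h : C.StabRel y y') (i : ι) :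
    C.cvec (C.typ y') i ≤ C.cvec (C.typ y) i := by
  obtain ⟨h, hx, rfl⟩ := h
  have hle := C.cvec_le (C.typ y) i
  obtain ⟨φ, h0, h1⟩ := C.exists_hom hπ y (m := l i) (c := π ^ C.cvec (C.typ y) i • 1) ⟨1, rfl⟩
  have hx' : h.symm (C.elem π) = C.elem π := by rw [LinearEquiv.symm_apply_eq, hx]
  have h2 := C.powDvd_hom hπ.ne_zero (φ := φ ∘ₗ h.symm.toLinearMap) (by
    rw [LinearMap.comp_apply, LinearEquiv.coe_coe, hx', h0]) (h y)
  rw [LinearMap.comp_apply, LinearEquiv.coe_coe, LinearEquiv.symm_apply_apply, h1] at h2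
  have h3 := (Cyc.powDvd_iff (homVal_le _ _ _)).mp h2
  rwa [Cyc.val_pow_smul_one hπ hle] at h3

/-- If `g` fixes `e`, then `id - g` kills `e` and sends `y` to `y - y'`. Conversely the box supplies
`n`, `n'` killing `e` such that `id + n` and `id + n'` exchange the pairs `(e, y)` and `(e, y')`,
and `exists_linearEquiv_of_end` applies. -/
theorem stabRel_iff [Finite (IsLocalRing.ResidueField R)] {y y' : CycProd π l} :
    C.StabRel y y' ↔ C.cvec (C.typ y) = C.cvec (C.typ y') ∧
      ∀ i, PowDvd π (C.cvec (C.typ y) i) (y i - y' i) := by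
  constructor
  · intro h
    refine ⟨funext fun i => le_antisymm (h.symm.cvec_le C hπ i) (h.cvec_le C hπ i), fun i => ?_⟩
    obtain ⟨g, hx, rfl⟩ := h
    exact C.powDvd_end hπ.ne_zero (n := LinearMap.id - g.toLinearMap) (by simp [hx]) y i
  · rintro ⟨hc, hd⟩
    obtain ⟨n, hn, hny⟩ := C.exists_end hπ y (a := y' - y) fun i => by
      have := (hd i).neg
      rwa [neg_sub] at this
    obtain ⟨n', hn', hny'⟩ := C.exists_end hπ y' (a := y - y') fun i => hc ▸ hd i
    have : ∀ i, Finite (Cyc π (l i)) := fun i => Cyc.finite hπ _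
    obtain ⟨h, hh⟩ := exists_linearEquiv_of_end (M := CycProd π l) ![C.elem π, y] ![C.elem π, y']
      (LinearMap.id + n) (LinearMap.id + n')
      (by
        intro k
        fin_cases k
        · simp [hn]
        · simp [hny])
      (by
        intro k
        fin_cases k
        · simp [hn']
        · simp [hny'])
    exact ⟨h, hh 0, hh 1⟩

/-- Here `cvec` of `y + a` is not known beforehand, so `stabRel_iff` is of no use. Since `a` lives
on the support, it is reached by `1 + projS ∘ n`, which is invertible because `projS ∘ n` is
nilpotent. -/
theorem stabRel_add (y : CycProd π l) {a : CycProd π l} (h0 : ∀ i ∉ C.S, a i = 0)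
    (ha : ∀ i ∈ C.S, PowDvd π (C.cvec (C.typ y) i) (a i)) : C.StabRel y (y + a) := by
  obtain ⟨n, hn, hny⟩ := C.exists_end hπ y (a := a) fun i => by
    by_cases hi : i ∈ C.S
    · exact ha i hi
    · rw [h0 i hi]
      exact PowDvd.zero_right _
  have hu : IsUnit (1 + C.projS ∘ₗ n : Module.End R (CycProd π l)) :=
    (C.isNilpotent_projS_comp hπ.ne_zero hn).isUnit_one_add
  let h := LinearEquiv.ofBijective _ ((Module.End.isUnit_iff _).mp hu)
  have hh (z : CycProd π l) : h z = z + C.projS (n z) := rfl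
  refine ⟨h, ?_, ?_⟩
  · rw [hh, hn, map_zero, add_zero]
  · rw [hh, hny]
    congr 1
    funext i
    by_cases hi : i ∈ C.S
    · exact C.projS_of_mem hi a
    · rw [C.projS_of_notMem hi, h0 i hi]

end Stabilizer

end AntichainData
-- Counting elements of given valuation and elements of boxes.
theorem card_preimage_of_surjective {G H : Type*} [AddCommGroup G] [AddCommGroup H] (f : G →+ H)
    (hf : Function.Surjective f) (T : Set H) :
    Nat.card (f ⁻¹' T) = Nat.card T * Nat.card f.ker := by
  rw [← Nat.card_prod]
  choose s hs using hf
  exact Nat.card_congr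
    { toFun := fun g => (⟨f g, g.2⟩, ⟨g - s (f g), by simp [AddMonoidHom.mem_ker, hs]⟩)
      invFun := fun p => ⟨s p.1 + p.2, by
        have : f p.2 = 0 := p.2.2
        simp [hs, this]⟩
      left_inv := fun g => by simp
      right_inv := fun p => by
        have : f p.2 = 0 := p.2.2
        ext <;> simp [hs, this] }

section Valuations

/-- The number of elements of `R / π ^ k` of valuation `t` which are divisible by `π ^ j`, as a
polynomial in the cardinality of the residue field. -/
noncomputable def valPoly (j k t : ℕ) : ℤ[X] :=
  if min j k ≤ t then X ^ (k - t) - (if t < k then X ^ (k - t - 1) else 0) else 0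

theorem sum_valPoly (j k : ℕ) : ∑ t ∈ Finset.range (k + 1), valPoly j k t = X ^ (k - j) := by
  -- The sum telescopes from `t = k` downwards; its last `m + 1` terms add up to `X ^ m`.
  have h (m : ℕ) (hm : m ≤ k - j) :
      ∑ t ∈ Finset.range (k + 1), (if k - m ≤ t then valPoly j k t else 0) = X ^ m := by
    induction m with
    | zero =>
      rw [Finset.sum_eq_single k]
      · simp [valPoly]
      · intro t ht htk
        rw [if_neg]
        have := Finset.mem_range.mp ht
        omega
      · simp
    | succ m ih =>
      have h1 := ih (by omega)
      have h2 : ∀ t ∈ Finset.range (k + 1), (if k - (m + 1) ≤ t then valPoly j k t else 0) =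
          (if k - m ≤ t then valPoly j k t else 0) +
            (if t = k - (m + 1) then valPoly j k t else 0) := by
        intro t _
        split_ifs <;> first | omega | simp
      rw [Finset.sum_congr rfl h2, Finset.sum_add_distrib, h1, Finset.sum_ite_eq',
        if_pos (Finset.mem_range.mpr (by omega)), valPoly, if_pos (by omega), if_pos (by omega),
        show k - (k - (m + 1)) = m + 1 by omega, Nat.add_sub_cancel]
      ring
  rw [← h (k - j) le_rfl]
  refine Finset.sum_congr rfl fun t _ => ?_
  by_cases ht : k - (k - j) ≤ t
  · rw [if_pos ht]
  · rw [if_neg ht, valPoly, if_neg (by omega)]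

variable {R : Type*} [CommRing R] [IsDomain R] [IsDiscreteValuationRing R]
  [Finite (IsLocalRing.ResidueField R)] {π : R} (hπ : Irreducible π)

include hπ

theorem Cyc.card_val_eq (j : ℕ) {k t : ℕ} (ht : t ≤ k) :
    (Nat.card {b : Cyc π k // PowDvd π j b ∧ b.val = t} : ℤ) =
      (valPoly j k t).eval (Nat.card (IsLocalRing.ResidueField R) : ℤ) := by
  have := Cyc.finite hπ k
  have hle (n : ℕ) (hn : n ≤ k) :
      Nat.card {b : Cyc π k // n ≤ b.val} = Nat.card (IsLocalRing.ResidueField R) ^ (k - n) := by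
    rw [← Cyc.card_powDvd hπ]
    exact Nat.card_congr (Equiv.subtypeEquivRight fun b => (Cyc.powDvd_iff hn).symm)
  rw [valPoly]
  split_ifs with h1 h2
  · have h3 : Nat.card {b : Cyc π k // t ≤ b.val} =
        Nat.card {b : Cyc π k // PowDvd π j b ∧ b.val = t} +
          Nat.card {b : Cyc π k // t + 1 ≤ b.val} := by
      change Nat.card {b : Cyc π k | t ≤ b.val} = Nat.card {b : Cyc π k | PowDvd π j b ∧ b.val = t}
        + Nat.card {b : Cyc π k | t + 1 ≤ b.val}
      rw [Nat.card_coe_set_eq, Nat.card_coe_set_eq, Nat.card_coe_set_eq,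
        ← Set.ncard_union_eq]
      · congr 1
        ext b
        simp only [Set.mem_ofPred_eq, Set.mem_union]
        rw [Cyc.powDvd_iff_min]
        omega
      · rw [Set.disjoint_left]
        intro b hb hb'
        have := hb.2
        have : t + 1 ≤ b.val := hb'
        omega
    rw [hle t ht, hle (t + 1) h2, show k - (t + 1) = k - t - 1 by omega] at h3
    replace h3 := congrArg (Nat.cast : ℕ → ℤ) h3
    simp only [Nat.cast_add, Nat.cast_pow] at h3
    simp only [eval_sub, eval_pow, eval_X]
    rw [h3]
    ring
  · obtain rfl : t = k := by omega
    have h3 : Nat.card {b : Cyc π t // PowDvd π j b ∧ b.val = t} =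
        Nat.card {b : Cyc π t // t ≤ b.val} := by
      refine Nat.card_congr (Equiv.subtypeEquivRight fun b => ?_)
      have := b.val_le
      rw [Cyc.powDvd_iff_min]
      omega
    rw [h3, hle t le_rfl]
    simp
  · have : IsEmpty {b : Cyc π k // PowDvd π j b ∧ b.val = t} := by
      refine ⟨fun b => h1 ?_⟩
      have h2 := Cyc.powDvd_iff_min.mp b.2.1
      exact h2.trans b.2.2.le
    simp

end Valuations

section Box

variable {R : Type*} [CommRing R] {ι : Type*}

/-- The submodule of the elements whose `i`-th coordinate is divisible by `π ^ e i`. -/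
def boxSub (π : R) (l e : ι → ℕ) : Submodule R (CycProd π l) where
  carrier := {a | ∀ i, PowDvd π (e i) (a i)}
  zero_mem' := fun _ => PowDvd.zero_right _
  add_mem' := fun ha hb i => (ha i).add (hb i)
  smul_mem' := fun r _ h i => (h i).smul r

theorem card_boxSub [Fintype ι] [IsDomain R] [IsDiscreteValuationRing R] {π : R}
    (hπ : Irreducible π) (l e : ι → ℕ) :
    Nat.card (boxSub π l e) = Nat.card (IsLocalRing.ResidueField R) ^ ∑ i, (l i - e i) := by
  rw [← Finset.prod_pow_eq_pow_sum]
  simp_rw [← Cyc.card_powDvd hπ]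
  rw [← Nat.card_pi]
  exact Nat.card_congr (Equiv.subtypePiEquivPi (p := fun i (a : Cyc π (l i)) => PowDvd π (e i) a))

end Box

/-! ### The number of orbits with a given exponent vector. -/

namespace AntichainData

variable {ι : Type*} [Fintype ι] [DecidableEq ι] {l : ι → ℕ} (C : AntichainData ι l)

/-- The type `t` on the index set can be completed to a type with exponent vector `c`, with all
valuations at least `j`. -/
def Completable (j : ℕ) (c t : ι → ℕ) : Prop :=
  ∃ σ : ι → ℕ, (∀ i, j ≤ σ i ∧ σ i ≤ l i) ∧ C.cvec (fun i => if i ∈ C.S then t i else σ i) = c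

/-- The exponents of the submodule by which the elements of completable type are translated. -/
def wExp (j : ℕ) (c : ι → ℕ) (i : ι) : ℕ := if i ∈ C.S then max j (c i) else j

open Classical in
/-- The numerator of the number of orbits with exponent vector `c`. -/
noncomputable def numer (j : ℕ) (c : ι → ℕ) : ℤ[X] :=
  X ^ (∑ i, (l i - j)) * ∑ t ∈ Fintype.piFinset fun i => Finset.range (C.nu i + 1),
    if C.Completable j c t then ∏ i, valPoly j (C.nu i) (t i) else 0

/-- The exponent of the denominator of the number of orbits with exponent vector `c`. -/
def denomExp (j : ℕ) (c : ι → ℕ) : ℕ := ∑ i, (l i - C.wExp j c i) + ∑ i, (C.nu i - j)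

/-- The number of orbits of the stabilizer of `C.elem` on the elements divisible by `π ^ j`. -/
noncomputable def orbitPoly (j : ℕ) : ℤ[X] :=
  ∑ c ∈ Fintype.piFinset fun i => Finset.range (l i + 1), C.numer j c /ₘ X ^ C.denomExp j c

variable {R : Type*} [CommRing R] {π : R}

/-- The equivalence relation of the stabilizer of `C.elem` on the elements divisible by `π ^ j`. -/
def stabSetoid (π : R) (j : ℕ) : Setoid {y : CycProd π l // ∀ i, PowDvd π j (y i)} where
  r y y' := C.StabRel y.1 y'.1
  iseqv :=
    { refl := fun y => ⟨LinearEquiv.refl _ _, rfl, rfl⟩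
      symm := StabRel.symm
      trans := fun {y y' y''} ⟨h, hx, hy⟩ ⟨h', hx', hy'⟩ => ⟨h.trans h', by simp [hx, hx'], by
        simp [hy, hy']⟩ }

/-- The elements divisible by `π ^ j` of completable type. -/
def completableSet (π : R) (j : ℕ) (c : ι → ℕ) : Set (CycProd π l) :=
  {y | (∀ i, PowDvd π j (y i)) ∧ C.Completable j c (C.typ y)}

variable [IsDomain R] [IsDiscreteValuationRing R] (hπ : Irreducible π)

include hπ

-- On the support, `quotMap` sees only support coordinates; elsewhere it preserves valuations, so
-- these can be prescribed freely.
omit [Fintype ι] [IsDiscreteValuationRing R] in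
theorem typ_complete (y : CycProd π l) {σ : ι → ℕ} (hσ : ∀ i, σ i ≤ l i) :
    C.typ (fun i => if i ∈ C.S then y i else π ^ σ i • 1) =
      fun i => if i ∈ C.S then C.typ y i else σ i := by
  funext i
  by_cases hi : i ∈ C.S
  · rw [if_pos hi, typ, typ, C.quotMap_congr hi (y' := y)]
    intro j hj
    exact if_pos hj
  · rw [if_neg hi, typ, C.val_quotMap_of_notMem hi]
    simp only [if_neg hi]
    exact Cyc.val_pow_smul_one hπ (hσ i)

/-- Completability concerns only the support coordinates, so the others may be replaced by `π ^ σ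
i`. The translation is then one of those in `stabRel_add`, which preserve `cvec`. -/
theorem add_mem_completableSet {j : ℕ} {c : ι → ℕ} {y a : CycProd π l}
    (hy : y ∈ C.completableSet π j c) (ha : a ∈ boxSub π l (C.wExp j c)) :
    y + a ∈ C.completableSet π j c := by
  obtain ⟨hyj, σ, hσ, hc⟩ := hy
  have hS (i : ι) (hi : i ∈ C.S) : PowDvd π (max j (c i)) (a i) := by
    have := ha i
    rwa [wExp, if_pos hi] at this
  refine ⟨fun i => (hyj i).add ?_, σ, hσ, ?_⟩
  · refine (ha i).mono ?_
    rw [wExp]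
    split_ifs
    · exact le_max_left _ _
    · exact le_rfl
  · rw [← C.typ_complete hπ y fun i => (hσ i).2] at hc
    have h1 := C.stabRel_add hπ (fun i => if i ∈ C.S then y i else π ^ σ i • 1)
      (a := fun i => if i ∈ C.S then a i else 0) (fun i hi => if_neg hi) (fun i hi => by
        rw [hc, if_pos hi]
        exact (hS i hi).mono (le_max_right _ _))
    have h3 := funext fun i => le_antisymm (h1.cvec_le C hπ i) (h1.symm.cvec_le C hπ i)
    rw [← hc, ← h3, ← C.typ_complete hπ _ fun i => (hσ i).2]
    congr 2
    funext i
    by_cases hi : i ∈ C.S <;> simp [hi]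

omit [Fintype ι] [IsDomain R] [IsDiscreteValuationRing R] hπ in
theorem mem_completableSet {j : ℕ} (hj : ∀ i, j ≤ l i) {y : CycProd π l}
    (hy : ∀ i, PowDvd π j (y i)) : y ∈ C.completableSet π j (C.cvec (C.typ y)) := by
  refine ⟨hy, fun i => (y i).val, fun i => ⟨?_, Cyc.val_le _⟩, ?_⟩
  · exact (Cyc.powDvd_iff (hj i)).mp (hy i)
  · congr 1
    funext i
    split_ifs with hi
    · rfl
    · exact (C.val_quotMap_of_notMem hi y).symm

/-- Orbits are sorted by `cvec = c`. Such an orbit is determined by its support coordinates modulo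
`π ^ c i`, and which residues occur is completability. Off the support the box of `wExp` contains
all multiples of `π ^ j`, so those coordinates are forgotten. -/
theorem card_quotient_stabSetoid [Finite (IsLocalRing.ResidueField R)] {j : ℕ}
    (hj : ∀ i, j ≤ l i) :
    Nat.card (Quotient (C.stabSetoid π j)) =
      ∑ c ∈ Fintype.piFinset fun i => Finset.range (l i + 1),
        Nat.card ((boxSub π l (C.wExp j c)).mkQ '' C.completableSet π j c) := by
  classical
  have : ∀ i, Finite (Cyc π (l i)) := fun i => Cyc.finite hπ _
  have : Finite (Quotient (C.stabSetoid π j)) := Quotient.finite _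
  have := Fintype.ofFinite (Quotient (C.stabSetoid π j))
  rw [Nat.card_eq_fintype_card, ← Finset.card_univ,
    Finset.card_eq_sum_card_fiberwise (f := fun q => C.cvec (C.typ q.out.1))
      (t := Fintype.piFinset fun i => Finset.range (l i + 1))
      (fun q _ => by
        simp only [Finset.mem_coe, Fintype.mem_piFinset, Finset.mem_range]
        exact fun i => Nat.lt_succ_of_le (C.cvec_le _ i))]
  refine Finset.sum_congr rfl fun c _ => ?_
  have himage : (boxSub π l (C.wExp j c)).mkQ '' C.completableSet π j c =
      (fun q : Quotient (C.stabSetoid π j) => (boxSub π l (C.wExp j c)).mkQ q.out.1) ''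
        (Finset.univ.filter fun q : Quotient (C.stabSetoid π j) => C.cvec (C.typ q.out.1) = c :
          Finset (Quotient (C.stabSetoid π j))) := by
    ext z
    constructor
    · rintro ⟨y, ⟨hyj, σ, hσ, hc⟩, rfl⟩
      rw [← C.typ_complete hπ y fun i => (hσ i).2] at hc
      let y₁ : {y : CycProd π l // ∀ i, PowDvd π j (y i)} :=
        ⟨fun i => if i ∈ C.S then y i else π ^ σ i • 1, fun i => by
          by_cases hi : i ∈ C.S
          · simpa only [if_pos hi] using hyj i
          · simp only [if_neg hi]
            exact PowDvd.mono ⟨1, rfl⟩ (hσ i).1⟩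
      let q : Quotient (C.stabSetoid π j) := Quotient.mk _ y₁
      have hq : C.StabRel q.out.1 y₁.1 := Quotient.mk_out (s := C.stabSetoid π j) y₁
      rw [C.stabRel_iff hπ] at hq
      refine ⟨q, ?_, ?_⟩
      · simp only [Finset.coe_filter, Finset.mem_univ, true_and, Set.mem_ofPred_eq]
        rw [hq.1, hc]
      · simp only [Submodule.mkQ_apply]
        rw [Submodule.Quotient.eq]
        intro i
        rw [wExp]
        split_ifs with hi
        · have h1 : PowDvd π j (q.out.1 i - y i) := (q.out.2 i).sub (hyj i)
          have h2 : PowDvd π (c i) (q.out.1 i - y i) := by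
            have := hq.2 i
            rw [hq.1, hc] at this
            simpa only [y₁, if_pos hi] using this
          rcases max_choice j (c i) with h | h <;> rw [h] <;> assumption
        · exact (q.out.2 i).sub (hyj i)
    · rintro ⟨q, hq, rfl⟩
      simp only [Finset.coe_filter, Finset.mem_univ, true_and, Set.mem_ofPred_eq] at hq
      refine ⟨q.out.1, ?_, rfl⟩
      rw [← hq]
      exact C.mem_completableSet hj q.out.2
  rw [himage, Nat.card_coe_set_eq, Set.InjOn.ncard_image, Set.ncard_coe_finset]
  intro q hq q' hq' h
  simp only [Finset.coe_filter, Finset.mem_univ, true_and, Set.mem_ofPred_eq] at hq hq'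
  simp only [Submodule.mkQ_apply] at h
  rw [Submodule.Quotient.eq] at h
  rw [← q.out_eq, ← q'.out_eq]
  refine Quotient.sound (s := C.stabSetoid π j) ((C.stabRel_iff hπ).mpr ⟨hq.trans hq'.symm, ?_⟩)
  intro i
  have h1 := h i
  rw [wExp] at h1
  split_ifs at h1 with hi
  · rw [hq]
    exact h1.mono (le_max_right _ _)
  -- Off the support, `c i` is at most the valuation of the coordinate itself, so both coordinates
  -- are already zero modulo `π ^ c i`.
  · have h2 (q : Quotient (C.stabSetoid π j)) (hq : C.cvec (C.typ q.out.1) = c) :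
        PowDvd π (c i) (q.out.1 i) := by
      rw [← hq, Cyc.powDvd_iff (C.cvec_le _ i)]
      have h3 := homVal_le_add C.nu (C.typ q.out.1) (l i) i
      rw [C.nu_of_notMem hi, Nat.sub_self, add_zero, typ, C.val_quotMap_of_notMem hi] at h3
      exact h3
    rw [hq]
    exact (h2 q hq).sub (h2 q' hq')

theorem card_image_completableSet (j : ℕ) (c : ι → ℕ) :
    Nat.card ((boxSub π l (C.wExp j c)).mkQ '' C.completableSet π j c) *
      Nat.card (IsLocalRing.ResidueField R) ^ (∑ i, (l i - C.wExp j c i)) =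
        Nat.card (C.completableSet π j c) := by
  have h := card_preimage_of_surjective (boxSub π l (C.wExp j c)).mkQ.toAddMonoidHom
    (Submodule.mkQ_surjective _) ((boxSub π l (C.wExp j c)).mkQ '' C.completableSet π j c)
  have h1 : (boxSub π l (C.wExp j c)).mkQ.toAddMonoidHom ⁻¹'
      ((boxSub π l (C.wExp j c)).mkQ '' C.completableSet π j c) = C.completableSet π j c := by
    ext y
    constructor
    · rintro ⟨z, hz, hzy⟩
      have h2 : y - z ∈ boxSub π l (C.wExp j c) := by
        rw [← Submodule.Quotient.eq]
        exact hzy.symm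
      have := C.add_mem_completableSet hπ hz h2
      rwa [add_sub_cancel] at this
    · intro hy
      exact ⟨y, hy, rfl⟩
  have h2 : Nat.card (boxSub π l (C.wExp j c)).mkQ.toAddMonoidHom.ker =
      Nat.card (boxSub π l (C.wExp j c)) := by
    refine Nat.card_congr (Equiv.subtypeEquivRight fun y => ?_)
    exact Submodule.Quotient.mk_eq_zero _
  rw [h1, h2, card_boxSub hπ] at h
  exact h.symm

/-- `quotMap` maps the multiples of `π ^ j` onto the multiples of `π ^ j` with fibres of constant
size, and completability depends only on the image. The fibre size is eliminated by
cross-multiplication. -/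
theorem card_completableSet (j : ℕ) (c : ι → ℕ) :
    Nat.card (C.completableSet π j c) *
      Nat.card (IsLocalRing.ResidueField R) ^ (∑ i, (C.nu i - j)) =
        Nat.card (IsLocalRing.ResidueField R) ^ (∑ i, (l i - j)) *
          Nat.card {b : CycProd π C.nu // (∀ i, PowDvd π j (b i)) ∧
            C.Completable j c fun i => (b i).val} := by
  let D := boxSub π l fun _ => j
  let D' := boxSub π C.nu fun _ => j
  let f : D →ₗ[R] D' := C.quotMap.restrict fun y hy i => (powDvd_pi.mpr hy).map
    (LinearMap.proj i ∘ₗ C.quotMap)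
  have hf : Function.Surjective f := by
    rintro ⟨b, hb⟩
    obtain ⟨b, rfl⟩ := powDvd_pi.mpr hb
    obtain ⟨y, rfl⟩ := C.quotMap_surjective b
    exact ⟨⟨π ^ j • y, fun i => ⟨y i, rfl⟩⟩, Subtype.ext (map_smul C.quotMap (π ^ j) y)⟩
  have h1 := card_preimage_of_surjective f.toAddMonoidHom hf
    {b | C.Completable j c fun i => (b.1 i).val}
  have h2 := card_preimage_of_surjective f.toAddMonoidHom hf Set.univ
  have h3 : Nat.card (f.toAddMonoidHom ⁻¹' {b | C.Completable j c fun i => (b.1 i).val}) =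
      Nat.card (C.completableSet π j c) :=
    Nat.card_congr (Equiv.subtypeSubtypeEquivSubtypeInter (fun y : CycProd π l => y ∈ D)
      (fun y => C.Completable j c (C.typ y)))
  have h4 : Nat.card {b : D' | C.Completable j c fun i => (b.1 i).val} =
      Nat.card {b : CycProd π C.nu // (∀ i, PowDvd π j (b i)) ∧
            C.Completable j c fun i => (b i).val} :=
    Nat.card_congr (Equiv.subtypeSubtypeEquivSubtypeInter (fun y : CycProd π C.nu => y ∈ D')
      (fun y => C.Completable j c fun i => (y i).val))
  rw [Set.preimage_univ, Nat.card_coe_set_eq, Nat.card_coe_set_eq, Set.ncard_univ, Set.ncard_univ,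
    card_boxSub hπ, card_boxSub hπ] at h2
  rw [h3, h4] at h1
  rw [h1, h2]
  ring

variable [Finite (IsLocalRing.ResidueField R)]

theorem card_completable (j : ℕ) (c : ι → ℕ) :
    (Nat.card {b : CycProd π C.nu // (∀ i, PowDvd π j (b i)) ∧
      C.Completable j c fun i => (b i).val} : ℤ) =
    (∑ t ∈ Fintype.piFinset fun i => Finset.range (C.nu i + 1), open Classical in
      if C.Completable j c t then ∏ i, valPoly j (C.nu i) (t i) else 0).eval
        (Nat.card (IsLocalRing.ResidueField R) : ℤ) := by
  classical
  have : ∀ i, Finite (Cyc π (C.nu i)) := fun i => Cyc.finite hπ _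
  have := Fintype.ofFinite (CycProd π C.nu)
  rw [Nat.card_eq_fintype_card, Fintype.card_subtype,
    Finset.card_eq_sum_card_fiberwise (f := fun b i => (b i).val)
      (t := Fintype.piFinset fun i => Finset.range (C.nu i + 1))
      (fun b _ => by
        simp only [Finset.mem_coe, Fintype.mem_piFinset, Finset.mem_range]
        exact fun i => Nat.lt_succ_of_le (Cyc.val_le _)), eval_finsetSum]
  push_cast
  refine Finset.sum_congr rfl fun t ht => ?_
  rw [Finset.filter_filter]
  split_ifs with h
  · have hval (i : ι) : (Nat.card {b : Cyc π (C.nu i) // PowDvd π j b ∧ b.val = t i} : ℤ) =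
        (valPoly j (C.nu i) (t i)).eval (Nat.card (IsLocalRing.ResidueField R) : ℤ) :=
      Cyc.card_val_eq hπ j (by
        have := Finset.mem_range.mp (Fintype.mem_piFinset.mp ht i)
        omega)
    rw [eval_prod]
    simp_rw [← hval]
    rw [← Nat.cast_prod, ← Nat.card_pi, ← Fintype.card_subtype, ← Nat.card_eq_fintype_card]
    congr 1
    refine (Nat.card_congr (Equiv.subtypeEquivRight fun b => ?_)).trans
      (Nat.card_congr (Equiv.subtypePiEquivPi
        (p := fun i (b : Cyc π (C.nu i)) => PowDvd π j b ∧ b.val = t i)))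
    constructor
    · rintro ⟨⟨h1, -⟩, h2⟩ i
      exact ⟨h1 i, congrFun h2 i⟩
    · intro h1
      have h2 : (fun i => (b i).val) = t := funext fun i => (h1 i).2
      exact ⟨⟨fun i => (h1 i).1, by rwa [h2]⟩, h2⟩
  · rw [eval_zero, Nat.cast_eq_zero, Finset.card_eq_zero]
    refine Finset.filter_eq_empty_iff.mpr ?_
    rintro b - ⟨⟨-, h1⟩, h2⟩
    exact h (h2 ▸ h1)

theorem card_image_mul_eq_eval_numer (j : ℕ) (c : ι → ℕ) :
    (Nat.card ((boxSub π l (C.wExp j c)).mkQ '' C.completableSet π j c) : ℤ) *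
      (Nat.card (IsLocalRing.ResidueField R) : ℤ) ^ C.denomExp j c =
        (C.numer j c).eval (Nat.card (IsLocalRing.ResidueField R) : ℤ) := by
  have h1 := C.card_image_completableSet hπ j c
  have h2 := C.card_completableSet hπ j c
  have h3 := C.card_completable hπ j c
  rw [numer, eval_mul, ← h3, eval_pow, eval_X, denomExp, pow_add, ← mul_assoc]
  rw [← h1] at h2
  exact_mod_cast h2

end AntichainData
-- Divisibility by powers of `X`, and non-negative coefficients.
theorem X_pow_dvd_of_forall_prime (d : ℕ) (f : ℤ[X])
    (h : ∀ p : ℕ, p.Prime → (p : ℤ) ^ d ∣ f.eval (p : ℤ)) : X ^ d ∣ f := by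
  induction d generalizing f with
  | zero => simp
  | succ d ih =>
    -- `f(p)` is congruent to `f(0)` modulo `p`, so a prime exceeding `|f(0)|` divides the constant
    -- term.
    have h0 : f.coeff 0 = 0 := by
      obtain ⟨p, hp, hprime⟩ := Nat.exists_infinite_primes ((f.coeff 0).natAbs + 1)
      refine Int.eq_zero_of_dvd_of_natAbs_lt_natAbs (d := p) ?_ (by simpa using hp)
      have h1 := (Dvd.intro_left _ (pow_succ (p : ℤ) d).symm).trans (h p hprime)
      have h2 := sub_dvd_eval_sub (p : ℤ) 0 f
      rw [sub_zero, ← coeff_zero_eq_eval_zero] at h2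
      exact (dvd_sub_right h1).mp h2
    obtain ⟨g, rfl⟩ := X_dvd_iff.mpr h0
    rw [pow_succ']
    refine mul_dvd_mul_left _ (ih g fun p hp => ?_)
    have h1 := h p hp
    rw [eval_mul, eval_X, pow_succ'] at h1
    exact (mul_dvd_mul_iff_left (by exact_mod_cast hp.ne_zero)).mp h1

theorem card_residueField_padicInt (p : ℕ) [Fact p.Prime] :
    Nat.card (IsLocalRing.ResidueField ℤ_[p]) = p := by
  rw [Nat.card_congr PadicInt.residueField.toEquiv, Nat.card_zmod]

theorem NonnegCoeffs.add {f g : ℤ[X]} (hf : NonnegCoeffs f) (hg : NonnegCoeffs g) :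
    NonnegCoeffs (f + g) := fun i => by
  rw [coeff_add]
  exact add_nonneg (hf i) (hg i)

theorem NonnegCoeffs.sum {κ : Type*} (s : Finset κ) (f : κ → ℤ[X])
    (h : ∀ i ∈ s, NonnegCoeffs (f i)) : NonnegCoeffs (∑ i ∈ s, f i) := fun n => by
  rw [finsetSum_coeff]
  exact Finset.sum_nonneg fun i hi => h i hi n

theorem NonnegCoeffs.zero : NonnegCoeffs 0 := fun _ => by simp

theorem NonnegCoeffs.X_pow (n : ℕ) : NonnegCoeffs (X ^ n) := fun i => by
  rw [coeff_X_pow]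
  split_ifs <;> simp

namespace AntichainData

variable {ι : Type*} [Fintype ι] [DecidableEq ι] {l : ι → ℕ} (C : AntichainData ι l)

/-- Over `ℤ_[p]` the value of `numer` at `p` is a cardinality times `p ^ denomExp`. Every prime
occurs, which is enough for divisibility of polynomials. -/
theorem X_pow_denomExp_dvd (j : ℕ) (c : ι → ℕ) : X ^ C.denomExp j c ∣ C.numer j c := by
  refine X_pow_dvd_of_forall_prime _ _ fun p hp => ?_
  have : Fact p.Prime := ⟨hp⟩
  have hcard := card_residueField_padicInt p
  have : Finite (IsLocalRing.ResidueField ℤ_[p]) :=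
    Nat.finite_of_card_ne_zero (by rw [hcard]; exact hp.ne_zero)
  have h := C.card_image_mul_eq_eval_numer (PadicInt.irreducible_p (p := p)) j c
  rw [hcard] at h
  exact ⟨_, by rw [← h, mul_comm]⟩

theorem card_quotient_eq_eval {R : Type*} [CommRing R] [IsDomain R] [IsDiscreteValuationRing R]
    [Finite (IsLocalRing.ResidueField R)] {π : R} (hπ : Irreducible π) {j : ℕ}
    (hj : ∀ i, j ≤ l i) :
    (Nat.card (Quotient (C.stabSetoid π j)) : ℤ) =
      (C.orbitPoly j).eval (Nat.card (IsLocalRing.ResidueField R) : ℤ) := by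
  rw [C.card_quotient_stabSetoid hπ hj, orbitPoly, eval_finsetSum]
  push_cast
  refine Finset.sum_congr rfl fun c _ => ?_
  have h := C.card_image_mul_eq_eval_numer hπ j c
  obtain ⟨g, hg⟩ := C.X_pow_denomExp_dvd j c
  rw [hg, mul_divByMonic_cancel_left _ (monic_X_pow _)]
  rw [hg, eval_mul, eval_pow, eval_X, mul_comm] at h
  exact mul_left_cancel₀ (pow_ne_zero _ (by exact_mod_cast Nat.card_pos.ne')) h

/-! ### Principal ideals of height zero. -/

section Principal

variable {i₀ : ι} (hS : C.S = {i₀}) (hv : C.v i₀ = 0)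

include hS hv

-- Here `e` generates the summand of `i₀`, which vanishes in the quotient; the only possible
-- valuation there is `0`.
omit [Fintype ι] in
theorem nu_eq_zero : C.nu i₀ = 0 := by
  rw [C.nu_of_min (by simp [hS]) (by simp [hS]), hv]

omit [Fintype ι] hv in
theorem completable_iff {j : ℕ} {c t : ι → ℕ} (ht : t i₀ = 0) :
    C.Completable j c t ↔ C.Completable j c 0 := by
  have h (σ : ι → ℕ) : (fun i => if i ∈ C.S then t i else σ i) =
      fun i => if i ∈ C.S then (0 : ι → ℕ) i else σ i := by
    funext i
    split_ifs with hi
    · rw [hS, Finset.mem_singleton] at hi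
      rw [hi, ht, Pi.zero_apply]
    · rfl
  simp only [Completable, h]

-- Completability no longer depends on `t`, so the valuations are summed freely by `sum_valPoly`.
-- The powers of `X` in numerator and denominator then cancel except at `i₀`.
open Classical in
theorem orbitPoly_eq {j : ℕ} (hj : ∀ i, j ≤ l i) :
    C.orbitPoly j = ∑ c ∈ Fintype.piFinset fun i => Finset.range (l i + 1),
      if C.Completable j c 0 then X ^ (max j (c i₀) - j) else 0 := by
  refine Finset.sum_congr rfl fun c hc => ?_
  have hci : c i₀ ≤ l i₀ := Nat.le_of_lt_succ (Finset.mem_range.mp (Fintype.mem_piFinset.mp hc i₀))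
  have h1 : (∑ t ∈ Fintype.piFinset fun i => Finset.range (C.nu i + 1),
      if C.Completable j c t then ∏ i, valPoly j (C.nu i) (t i) else 0) =
        if C.Completable j c 0 then X ^ ∑ i, (C.nu i - j) else 0 := by
    have h2 : ∀ t ∈ Fintype.piFinset fun i => Finset.range (C.nu i + 1),
        (if C.Completable j c t then ∏ i, valPoly j (C.nu i) (t i) else 0) =
          if C.Completable j c 0 then ∏ i, valPoly j (C.nu i) (t i) else 0 := by
      intro t ht
      have h3 := Finset.mem_range.mp (Fintype.mem_piFinset.mp ht i₀)
      rw [C.nu_eq_zero hS hv] at h3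
      simp only [C.completable_iff hS (Nat.lt_one_iff.mp h3)]
    rw [Finset.sum_congr rfl h2]
    split_ifs
    · rw [← Finset.prod_univ_sum]
      simp_rw [sum_valPoly]
      rw [Finset.prod_pow_eq_pow_sum]
    · exact Finset.sum_const_zero
  rw [numer, h1]
  split_ifs
  · have h4 : ∑ i, (l i - j) = ∑ i, (l i - C.wExp j c i) + (max j (c i₀) - j) := by
      rw [← Finset.add_sum_erase _ _ (Finset.mem_univ i₀),
        ← Finset.add_sum_erase _ (fun i => l i - C.wExp j c i) (Finset.mem_univ i₀)]
      have h5 : ∑ i ∈ Finset.univ.erase i₀, (l i - C.wExp j c i) =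
          ∑ i ∈ Finset.univ.erase i₀, (l i - j) := by
        refine Finset.sum_congr rfl fun i hi => ?_
        rw [wExp, if_neg]
        rw [hS, Finset.mem_singleton]
        exact Finset.ne_of_mem_erase hi
      have h6 : C.wExp j c i₀ = max j (c i₀) := by
        rw [wExp, if_pos (by simp [hS])]
      have := hj i₀
      rw [h5, h6]
      omega
    rw [denomExp, h4, pow_add, mul_right_comm, ← pow_add,
      mul_divByMonic_cancel_left _ (monic_X_pow _)]
  · rw [mul_zero, zero_divByMonic]

theorem nonnegCoeffs_orbitPoly {j : ℕ} (hj : ∀ i, j ≤ l i) : NonnegCoeffs (C.orbitPoly j) := by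
  classical
  rw [C.orbitPoly_eq hS hv hj]
  refine NonnegCoeffs.sum _ _ fun c _ => ?_
  split_ifs
  · exact NonnegCoeffs.X_pow _
  · exact NonnegCoeffs.zero

theorem natDegree_orbitPoly_le {j : ℕ} (hj : ∀ i, j ≤ l i) :
    (C.orbitPoly j).natDegree ≤ l i₀ := by
  classical
  rw [C.orbitPoly_eq hS hv hj]
  refine natDegree_sum_le_of_forall_le _ _ fun c hc => ?_
  have hci := Finset.mem_range.mp (Fintype.mem_piFinset.mp hc i₀)
  have := hj i₀
  split_ifs
  · rw [natDegree_X_pow]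
    omega
  · simp

theorem coeff_orbitPoly_pos : 0 < (C.orbitPoly 0).coeff (l i₀) := by
  classical
  rw [C.orbitPoly_eq hS hv fun _ => Nat.zero_le _, finsetSum_coeff]
  have hnonneg : ∀ c ∈ Fintype.piFinset fun i => Finset.range (l i + 1), 0 ≤
      (if C.Completable 0 c 0 then (X : ℤ[X]) ^ (max 0 (c i₀) - 0) else 0).coeff (l i₀) := by
    intro c _
    split_ifs
    · exact NonnegCoeffs.X_pow _ _
    · simp
  refine lt_of_lt_of_le ?_ (Finset.single_le_sum hnonneg (a := l) (by simp))
  -- The vector `l` belongs to `y = 0`, whose box is zero; it contributes `X ^ l i₀`.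
  have hl : C.Completable 0 l 0 := by
    refine ⟨l, fun i => ⟨Nat.zero_le _, le_rfl⟩, funext fun i => ?_⟩
    refine le_antisymm (C.cvec_le _ i) ?_
    rw [cvec]
    rcases homVal_eq_or C.nu (fun i => if i ∈ C.S then (0 : ι → ℕ) i else l i) (l i)
      with h | ⟨k, hk⟩
    · exact h.ge
    · rw [hk]
      split_ifs with hkS
      · rw [hS, Finset.mem_singleton] at hkS
        rw [hkS, C.nu_eq_zero hS hv]
        omega
      · rw [C.nu_of_notMem hkS]
        omega
  rw [if_pos hl]
  simp

end Principal

end AntichainData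
-- From order ideals to antichains of rows.
section Ideals

theorem FundPoset.le_def {p p' : FundPoset} : p ≤ p' ↔ p'.v ≤ p.v ∧ p.l - p.v ≤ p'.l - p'.v :=
  Iff.rfl

theorem eq_of_mem_maxSet {I : LowerSet FundPoset} {p p' : FundPoset} (hp : p ∈ maxSet I)
    (hp' : p' ∈ maxSet I) (h : p ≤ p') : p = p' :=
  le_antisymm h (hp.2 hp'.1 h)

theorem lt_of_mem_maxSet {I : LowerSet FundPoset} {p p' : FundPoset} (hp : p ∈ maxSet I)
    (hp' : p' ∈ maxSet I) (h : p.l < p'.l) : p.v < p'.v ∧ p.l - p.v < p'.l - p'.v := by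
  have hne : p ≠ p' := fun h' => h.ne (congrArg FundPoset.l h')
  have h1 : ¬ p ≤ p' := fun h' => hne (eq_of_mem_maxSet hp hp' h')
  have h2 : ¬ p' ≤ p := fun h' => hne (eq_of_mem_maxSet hp' hp h').symm
  rw [FundPoset.le_def] at h1 h2
  have := p.v_lt
  have := p'.v_lt
  omega

theorem eq_of_mem_maxSet_of_l_eq {I : LowerSet FundPoset} {p p' : FundPoset} (hp : p ∈ maxSet I)
    (hp' : p' ∈ maxSet I) (h : p.l = p'.l) : p = p' := by
  rcases le_total p.v p'.v with h' | h'
  · exact (eq_of_mem_maxSet hp' hp (FundPoset.le_def.mpr ⟨h', by omega⟩)).symm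
  · exact eq_of_mem_maxSet hp hp' (FundPoset.le_def.mpr ⟨h', by omega⟩)

variable {μ : Ptn}

/-- The length of the row. -/
abbrev rowLen (μ : Ptn) (r : Row μ) : ℕ := r.1

theorem mult_pos_of_mem {k : ℕ} (hk : k ∈ μ.mult.support) : 0 < μ.mult k :=
  Nat.pos_of_ne_zero (Finsupp.mem_support_iff.mp hk)

theorem pos_of_mem_support {k : ℕ} (hk : k ∈ μ.mult.support) : 0 < k := by
  rcases Nat.eq_zero_or_pos k with rfl | h
  · exact absurd μ.mult_zero (Finsupp.mem_support_iff.mp hk)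
  · exact h

theorem one_le_rowLen (r : Row μ) : 1 ≤ rowLen μ r := pos_of_mem_support r.1.2

/-- The first row of a given length. -/
def firstRow {k : ℕ} (hk : k ∈ μ.mult.support) : Row μ := ⟨⟨k, hk⟩, ⟨0, mult_pos_of_mem hk⟩⟩

theorem eq_firstRow {r : Row μ} (hr : (r.2 : ℕ) = 0) {k : ℕ} (hk : k ∈ μ.mult.support)
    (h : (r.1 : ℕ) = k) : r = firstRow hk := by
  obtain ⟨⟨m, hm⟩, ⟨i, hi⟩⟩ := r
  simp only at hr h
  subst hr h
  rfl

open Classical in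
/-- The exponents of the canonical element. -/
noncomputable def PtnIdeal.rowExp (I : PtnIdeal μ) (r : Row μ) : ℕ :=
  if h : ∃ p ∈ maxSet I.1, p.l = r.1 then h.choose.v else 0

open Classical in
/-- The rows in which the canonical element does not vanish. -/
noncomputable def PtnIdeal.rowSet (I : PtnIdeal μ) : Finset (Row μ) :=
  {r | (r.2 : ℕ) = 0 ∧ ∃ p ∈ maxSet I.1, p.l = r.1}

theorem PtnIdeal.exists_of_mem_rowSet {I : PtnIdeal μ} {r : Row μ} (hr : r ∈ I.rowSet) :
    ∃ p ∈ maxSet I.1, p.l = r.1 ∧ p.v = I.rowExp r := by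
  simp only [PtnIdeal.rowSet, Finset.mem_filter, Finset.mem_univ, true_and] at hr
  refine ⟨hr.2.choose, hr.2.choose_spec.1, hr.2.choose_spec.2, ?_⟩
  rw [PtnIdeal.rowExp, dif_pos hr.2]

theorem PtnIdeal.exists_mem_rowSet {I : PtnIdeal μ} {p : FundPoset} (hp : p ∈ maxSet I.1) :
    ∃ r ∈ I.rowSet, p.l = r.1 ∧ p.v = I.rowExp r := by
  have hmem : firstRow (I.2.1 hp) ∈ I.rowSet := by
    simp only [PtnIdeal.rowSet, Finset.mem_filter, Finset.mem_univ, true_and]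
    exact ⟨rfl, p, hp, rfl⟩
  obtain ⟨p', hp', hl, hv⟩ := PtnIdeal.exists_of_mem_rowSet hmem
  have : p' = p := eq_of_mem_maxSet_of_l_eq hp' hp hl
  subst this
  exact ⟨_, hmem, rfl, hv⟩

/-- The antichain of the maximal elements of an ideal. -/
noncomputable def PtnIdeal.antichain (I : PtnIdeal μ) : AntichainData (Row μ) (rowLen μ) where
  S := I.rowSet
  v := I.rowExp
  v_lt i hi := by
    obtain ⟨p, -, hl, hv⟩ := PtnIdeal.exists_of_mem_rowSet hi
    have := p.v_lt
    rw [← hv]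
    change _ < (i.1 : ℕ)
    omega
  eq_of_eq i hi j hj h := by
    simp only [PtnIdeal.rowSet, Finset.mem_filter, Finset.mem_univ, true_and] at hi hj
    rw [eq_firstRow hi.1 j.1.2 h, ← eq_firstRow hj.1 j.1.2 rfl]
  lt_of_lt i hi j hj h := by
    obtain ⟨p, hp, hl, hv⟩ := PtnIdeal.exists_of_mem_rowSet hi
    obtain ⟨p', hp', hl', hv'⟩ := PtnIdeal.exists_of_mem_rowSet hj
    rw [← hv, ← hv', rowLen, rowLen, ← hl, ← hl']
    exact lt_of_mem_maxSet hp hp' (by rw [hl, hl']; exact h)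

theorem PtnIdeal.antichain_elem {R : Type*} [CommRing R] (π : R) (I : PtnIdeal μ) :
    I.antichain.elem π = canonicalElement R π μ I := by
  funext r
  rw [AntichainData.elem, canonicalElement]
  by_cases h : (r.2 : ℕ) = 0 ∧ ∃ p ∈ maxSet I.1, p.l = r.1
  · have hr : r ∈ I.antichain.S := by
      change r ∈ I.rowSet
      simpa [PtnIdeal.rowSet] using h
    rw [if_pos hr, dif_pos h, Cyc.mk_eq_smul_one]
    change π ^ I.rowExp r • _ = _
    rw [PtnIdeal.rowExp, dif_pos h.2]
  · have hr : r ∉ I.antichain.S := by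
      change r ∉ I.rowSet
      simpa [PtnIdeal.rowSet] using h
    rw [if_neg hr, dif_neg h]

theorem PtnIdeal.antichain_of_principal {I : PtnIdeal μ} (h0 : I.HeightZero)
    (hp : I.IsPrincipal) : ∃ r, I.antichain.S = {r} ∧ I.antichain.v r = 0 := by
  obtain ⟨p, hpI, hpv⟩ := h0
  obtain ⟨r, hr, hl, hv⟩ := PtnIdeal.exists_mem_rowSet hpI
  refine ⟨r, ?_, by rw [← hpv, hv]; rfl⟩
  refine Finset.eq_singleton_iff_unique_mem.mpr ⟨hr, fun r' hr' => ?_⟩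
  obtain ⟨p', hp', hl', -⟩ := PtnIdeal.exists_of_mem_rowSet hr'
  have : p' = p := hp hp' hpI
  exact I.antichain.eq_of_eq r' hr' r hr (by rw [rowLen, rowLen, ← hl', ← hl, this])

end Ideals

/-! ### Orbits of the stabilizers of the canonical elements. -/

section Counting

variable {R : Type*} [CommRing R] {π : R} {μ : Ptn} (I : PtnIdeal μ)

theorem stabRel_iff_exists_stab {y y' : Mod R π μ} :
    I.antichain.StabRel y y' ↔ ∃ g : Stab R π μ I, g • y = y' := by
  constructor
  · rintro ⟨h, hx, hy⟩
    rw [I.antichain_elem] at hx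
    exact ⟨⟨h, hx⟩, hy⟩
  · rintro ⟨⟨h, hx⟩, hy⟩
    refine ⟨h, ?_, hy⟩
    rw [I.antichain_elem]
    exact hx

variable [IsDomain R] [IsDiscreteValuationRing R] [Finite (IsLocalRing.ResidueField R)]
  (hπ : Irreducible π)

include hπ

theorem numStabOrbits_eq_eval : (numStabOrbits R π μ I : ℤ) =
    (I.antichain.orbitPoly 0).eval (Nat.card (IsLocalRing.ResidueField R) : ℤ) := by
  rw [← I.antichain.card_quotient_eq_eval hπ fun _ => Nat.zero_le _, numStabOrbits]
  congr 1
  refine Nat.card_congr (Quotient.congr (Equiv.subtypeUnivEquiv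
    fun y r => PowDvd.zero_left _).symm fun y y' => ?_)
  rw [MulAction.orbitRel_apply]
  change _ ↔ I.antichain.StabRel y y'
  rw [stabRel_iff_exists_stab]
  constructor
  · rintro ⟨g, rfl⟩
    exact ⟨g⁻¹, inv_smul_smul g y'⟩
  · rintro ⟨g, rfl⟩
    exact ⟨g⁻¹, inv_smul_smul g y⟩

theorem numStabOrbitsPi_eq_eval : (numStabOrbitsPi R π μ I : ℤ) =
    (I.antichain.orbitPoly 1).eval (Nat.card (IsLocalRing.ResidueField R) : ℤ) := by
  rw [← I.antichain.card_quotient_eq_eval hπ one_le_rowLen, numStabOrbitsPi]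
  congr 1
  have hmem (y : Mod R π μ) : y ∈ piMod R π μ (Stab R π μ I) ↔ ∀ r, PowDvd π 1 (y r) := by
    rw [← powDvd_pi]
    simp only [PowDvd, pow_one]
    rfl
  refine Nat.card_congr (Quotient.congr (Equiv.subtypeEquivRight hmem) fun y y' => ?_)
  rw [MulAction.orbitRel_apply]
  change _ ↔ I.antichain.StabRel y.1 y'.1
  rw [stabRel_iff_exists_stab]
  constructor
  · rintro ⟨g, rfl⟩
    exact ⟨g⁻¹, inv_smul_smul g y'.1⟩
  · rintro ⟨g, hg⟩
    refine ⟨g⁻¹, Subtype.ext ?_⟩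
    change g⁻¹ • y'.1 = y.1
    rw [← hg, inv_smul_smul]

end Counting
-- Canonical elements represent the orbits on single elements.
section Classification

variable {R : Type*} [CommRing R] {π : R} {μ : Ptn}

/-- The ideal generated by the orders and heights of the coordinates of an element. -/
noncomputable def idealOf (a : CycProd π (rowLen μ)) : LowerSet FundPoset where
  carrier := {p | ∃ r : Row μ, (a r).val + (p.l - r.1) ≤ p.v}
  lower' := by
    rintro p p' h ⟨r, hr⟩
    rw [FundPoset.le_def] at h
    have := p.v_lt
    have := p'.v_lt
    exact ⟨r, by omega⟩

theorem mem_idealOf {a : CycProd π (rowLen μ)} {p : FundPoset} :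
    p ∈ idealOf a ↔ ∃ r : Row μ, (a r).val + (p.l - r.1) ≤ p.v := Iff.rfl

theorem val_lt_of_mem_idealOf {a : CycProd π (rowLen μ)} {p : FundPoset} {r : Row μ}
    (h : (a r).val + (p.l - r.1) ≤ p.v) : (a r).val < r.1 := by
  have := p.v_lt
  omega

/-- The element of the fundamental poset given by a non-zero coordinate. -/
noncomputable def coordPoint (a : CycProd π (rowLen μ)) (r : Row μ) (h : (a r).val < (r.1 : ℕ)) : FundPoset :=
  ⟨(a r).val, r.1, h⟩

theorem coordPoint_mem (a : CycProd π (rowLen μ)) (r : Row μ) (h : (a r).val < (r.1 : ℕ)) :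
    coordPoint a r h ∈ idealOf a := ⟨r, by simp [coordPoint]⟩

theorem le_coordPoint {a : CycProd π (rowLen μ)} {p : FundPoset} {r : Row μ}
    (h : (a r).val + (p.l - r.1) ≤ p.v) : p ≤ coordPoint a r (val_lt_of_mem_idealOf h) := by
  rw [FundPoset.le_def]
  simp only [coordPoint]
  omega

/-- Every element of the ideal lies below one of the finitely many coordinate points, so a maximal
coordinate point is maximal in the whole ideal. -/
theorem idealOf_le_lowerClosure (a : CycProd π (rowLen μ)) :
    idealOf a ≤ lowerClosure (maxSet (idealOf a)) := by
  intro p hp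
  obtain ⟨r, hr⟩ := hp
  let T : Set FundPoset := {p | ∃ r, ∃ h : (a r).val < (r.1 : ℕ), p = coordPoint a r h}
  have hT : T.Finite := by
    refine (partSet_finite μ).subset ?_
    rintro _ ⟨r, h, rfl⟩
    exact r.1.2
  obtain ⟨m, hpm, hm⟩ := hT.exists_le_maximal (a := coordPoint a r (val_lt_of_mem_idealOf hr))
    ⟨r, _, rfl⟩
  refine ⟨m, ⟨?_, fun p' hp' hmp' => ?_⟩, (le_coordPoint hr).trans hpm⟩
  · obtain ⟨r', h', rfl⟩ := hm.1
    exact coordPoint_mem a r' h'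
  · obtain ⟨r', hr'⟩ := hp'
    exact (le_coordPoint hr').trans (hm.2 ⟨r', _, rfl⟩ (hmp'.trans (le_coordPoint hr')))

theorem exists_of_mem_maxSet_idealOf {a : CycProd π (rowLen μ)} {p : FundPoset} (hp : p ∈ maxSet (idealOf a)) :
    ∃ r : Row μ, p.l = r.1 ∧ p.v = (a r).val := by
  obtain ⟨r, hr⟩ := mem_idealOf.mp hp.1
  have := eq_of_mem_maxSet hp ⟨coordPoint_mem a r (val_lt_of_mem_idealOf hr),
    fun p' hp' h => hp.2 hp' ((le_coordPoint hr).trans h) |>.trans (le_coordPoint hr)⟩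
    (le_coordPoint hr)
  exact ⟨r, congrArg FundPoset.l this, congrArg FundPoset.v this⟩

/-- The ideal of an element, as an element of `J(P)_λ`. -/
noncomputable def ptnIdealOf (a : CycProd π (rowLen μ)) : PtnIdeal μ :=
  ⟨idealOf a, fun _ hp => by
    obtain ⟨r, hl, -⟩ := exists_of_mem_maxSet_idealOf hp
    change _ ∈ μ.mult.support
    rw [hl]
    exact r.1.2,
  le_antisymm (idealOf_le_lowerClosure a) (lowerClosure_le.mpr fun _ hp => hp.1)⟩

variable [IsDomain R] [IsDiscreteValuationRing R] (hπ : Irreducible π)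

include hπ

theorem exists_end_of_homVal_le (a b : CycProd π (rowLen μ))
    (h : ∀ r, b r = 0 ∨ ∃ k, (a k).val + (rowLen μ r - rowLen μ k) ≤ (b r).val) :
    ∃ f : CycProd π (rowLen μ) →ₗ[R] CycProd π (rowLen μ), f a = b := by
  have h' (r : Row μ) : ∃ φ : CycProd π (rowLen μ) →ₗ[R] Cyc π (rowLen μ r), φ a = b r := by
    refine CycProd.exists_hom hπ (l := rowLen μ) a ?_
    rcases h r with h | ⟨k, hk⟩
    · rw [h]
      exact PowDvd.zero_right _
    · exact (b r).powDvd_val.mono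
        ((homVal_le_add (rowLen μ) (fun i => (a i).val) (rowLen μ r) k).trans hk)
  choose φ hφ using h'
  exact ⟨LinearMap.pi φ, funext hφ⟩

omit [IsDiscreteValuationRing R] in
theorem val_elem {I : PtnIdeal μ} {r : Row μ} (hr : r ∈ I.rowSet) :
    (I.antichain.elem π r).val = I.rowExp r := by
  have h : I.antichain.elem π r = π ^ I.rowExp r • 1 := if_pos hr
  rw [h]
  exact Cyc.val_pow_smul_one hπ (I.antichain.v_lt r hr).le

omit [IsDomain R] [IsDiscreteValuationRing R] hπ in
theorem elem_eq_zero {I : PtnIdeal μ} {r : Row μ} (hr : r ∉ I.rowSet) :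
    I.antichain.elem π r = 0 := if_neg hr

/-- Endomorphisms in both directions suffice. The maximal elements of the ideal of `a` are
themselves coordinate points of `a`, and each coordinate point of `a` lies below one of them. -/
theorem exists_linearEquiv_elem [Finite (IsLocalRing.ResidueField R)] (a : CycProd π (rowLen μ)) :
    ∃ I : PtnIdeal μ, ∃ h : CycProd π (rowLen μ) ≃ₗ[R] CycProd π (rowLen μ), h (I.antichain.elem π) = a := by
  let I := ptnIdealOf a
  obtain ⟨f, hf⟩ := exists_end_of_homVal_le hπ a (I.antichain.elem π) fun r => by
    by_cases hr : r ∈ I.rowSet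
    · right
      obtain ⟨p, hp, hl, hv⟩ := PtnIdeal.exists_of_mem_rowSet hr
      obtain ⟨k, hkl, hkv⟩ := exists_of_mem_maxSet_idealOf hp
      refine ⟨k, ?_⟩
      have h1 : rowLen μ r - rowLen μ k = 0 := by
        simp only [rowLen]
        omega
      rw [val_elem hπ hr, ← hv, hkv, h1, add_zero]
    · exact Or.inl (elem_eq_zero hr)
  obtain ⟨g, hg⟩ := exists_end_of_homVal_le hπ (I.antichain.elem π) a fun r => by
    by_cases hr : (a r).val < (r.1 : ℕ)
    · right
      obtain ⟨m, hm, hle⟩ := idealOf_le_lowerClosure a (coordPoint_mem a r hr)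
      obtain ⟨k, hk, hl, hv⟩ := PtnIdeal.exists_mem_rowSet (I := I) hm
      refine ⟨k, ?_⟩
      rw [val_elem hπ hk, ← hv]
      rw [FundPoset.le_def] at hle
      simp only [coordPoint] at hle
      simp only [rowLen]
      have := m.v_lt
      omega
    · left
      have : (a r).val ≤ r.1 := (a r).val_le
      exact Cyc.val_eq_iff.mp (le_antisymm this (not_lt.mp hr))
  have : ∀ r : Row μ, Finite (Cyc π (rowLen μ r)) := fun r => Cyc.finite hπ _
  obtain ⟨h, hh⟩ := exists_linearEquiv_of_end (R := R) (M := CycProd π (rowLen μ)) (κ := Unit)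
    (fun _ => I.antichain.elem π) (fun _ => a) g f (fun _ => hg) (fun _ => hf)
  exact ⟨I, h, hh ()⟩

-- Homomorphisms move points only downwards in the fundamental poset, so each maximal element of `J`
-- lies below one of `I`.
omit [IsDiscreteValuationRing R] in
theorem ideal_le_of_end {I J : PtnIdeal μ} (f : CycProd π (rowLen μ) →ₗ[R] CycProd π (rowLen μ))
    (hf : f (I.antichain.elem π) = J.antichain.elem π) : J.1 ≤ I.1 := by
  rw [J.2.2, lowerClosure_le]
  intro p hp
  obtain ⟨r, hr, hl, hv⟩ := PtnIdeal.exists_mem_rowSet hp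
  have h1 := CycProd.powDvd_hom hπ.ne_zero (l := rowLen μ) (m := rowLen μ r)
    (LinearMap.proj (φ := fun r : Row μ => Cyc π (rowLen μ r)) r ∘ₗ f) (I.antichain.elem π)
  have h2 : (LinearMap.proj (φ := fun r : Row μ => Cyc π (rowLen μ r)) r ∘ₗ f)
      (I.antichain.elem π) = J.antichain.elem π r := congrFun hf r
  rw [h2, Cyc.powDvd_iff (homVal_le _ _ _), val_elem hπ hr, ← hv] at h1
  have hplt := p.v_lt
  rcases homVal_eq_or (rowLen μ) (fun i => (I.antichain.elem π i).val) (rowLen μ r)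
    with h | ⟨k, hk⟩
  · rw [h, rowLen, ← hl] at h1
    omega
  · rw [hk] at h1
    simp only [rowLen] at h1
    rw [← hl] at h1
    by_cases hkI : k ∈ I.rowSet
    · obtain ⟨p', hp', hl', hv'⟩ := PtnIdeal.exists_of_mem_rowSet hkI
      refine I.1.lower (a := p') ?_ hp'.1
      rw [val_elem hπ hkI, ← hv', ← hl'] at h1
      rw [FundPoset.le_def]
      have := p'.v_lt
      omega
    · rw [elem_eq_zero hkI, Cyc.val_zero] at h1
      omega

omit [IsDiscreteValuationRing R] in
theorem eq_of_linearEquiv_elem {I J : PtnIdeal μ} (h : CycProd π (rowLen μ) ≃ₗ[R] CycProd π (rowLen μ))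
    (hh : h (I.antichain.elem π) = J.antichain.elem π) : I = J := by
  refine Subtype.ext (le_antisymm (ideal_le_of_end hπ h.symm.toLinearMap ?_)
    (ideal_le_of_end hπ h.toLinearMap hh))
  rw [LinearEquiv.coe_coe, LinearEquiv.symm_apply_eq, hh]

omit [IsDiscreteValuationRing R] in
theorem heightZero_iff {I : PtnIdeal μ} :
    I.HeightZero ↔ ¬ PowDvd π 1 (I.antichain.elem π) := by
  rw [powDvd_pi, not_forall]
  constructor
  · rintro ⟨p, hp, hv0⟩
    obtain ⟨r, hr, hl, hv⟩ := PtnIdeal.exists_mem_rowSet hp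
    refine ⟨r, ?_⟩
    rw [Cyc.powDvd_iff (one_le_rowLen r), val_elem hπ hr, ← hv, hv0]
    omega
  · rintro ⟨r, hr⟩
    by_cases hrI : r ∈ I.rowSet
    · obtain ⟨p, hp, hl, hv⟩ := PtnIdeal.exists_of_mem_rowSet hrI
      refine ⟨p, hp, ?_⟩
      rw [Cyc.powDvd_iff (one_le_rowLen r), val_elem hπ hrI, ← hv] at hr
      omega
    · rw [elem_eq_zero hrI] at hr
      exact absurd (PowDvd.zero_right 1) hr

end Classification
-- Multiples of `π` as the module with the first column deleted.
section Shift

variable {R : Type*} [CommRing R] {π : R} {ι ι' : Type*} [Fintype ι] [DecidableEq ι] [Fintype ι']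
  [DecidableEq ι'] {l : ι → ℕ} {l' : ι' → ℕ} (e : ι' → ι) (hl : ∀ s, l (e s) = l' s + 1)

/-- The embedding of a product of cyclic modules whose image consists of the elements of a product
of longer cyclic modules which are divisible by `π`. -/
def shiftEmb : CycProd π l' →ₗ[R] CycProd π l :=
  prodLift π (fun s => Pi.single (e s) (π • 1)) (fun s => by
    rw [← Pi.single_smul, smul_smul, ← pow_succ, Cyc.pow_smul_eq_zero π (hl s).le, Pi.single_zero])

omit [Fintype ι] in
theorem shiftEmb_single (s : ι') :
    shiftEmb (π := π) e hl (Pi.single s 1) = π • Pi.single (e s) 1 := by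
  rw [shiftEmb, prodLift_single, Pi.single_smul]

omit [Fintype ι] in
theorem shiftEmb_apply (he : Function.Injective e) (a : CycProd π l') (s : ι') :
    shiftEmb e hl a (e s) = cycScale 1 (hl s).le (a s) := by
  have h : LinearMap.proj (φ := fun i => Cyc π (l i)) (e s) ∘ₗ shiftEmb e hl =
      cycScale 1 (hl s).le ∘ₗ LinearMap.proj (φ := fun i => Cyc π (l' i)) s := by
    refine CycProd.hom_ext π fun t => ?_
    simp only [LinearMap.comp_apply, LinearMap.proj_apply]
    rw [shiftEmb_single, Pi.smul_apply]
    by_cases hts : t = s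
    · subst hts
      have := cycScale_smul_one (π := π) (hl t).le 1
      rw [one_smul, one_mul, pow_one] at this
      rw [Pi.single_eq_same, Pi.single_eq_same, this]
    · rw [Pi.single_eq_of_ne (Ne.symm hts), Pi.single_eq_of_ne (fun h => hts (he h).symm),
        smul_zero, map_zero]
  exact LinearMap.congr_fun h a

omit [Fintype ι] in
theorem shiftEmb_apply_of_notMem (a : CycProd π l') {r : ι} (hr : ∀ s, e s ≠ r) :
    shiftEmb e hl a r = 0 := by
  have h : LinearMap.proj (φ := fun i => Cyc π (l i)) r ∘ₗ shiftEmb e hl =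
      (0 : CycProd π l' →ₗ[R] Cyc π (l r)) := by
    refine CycProd.hom_ext π fun t => ?_
    simp only [LinearMap.comp_apply, LinearMap.proj_apply]
    rw [shiftEmb_single, Pi.smul_apply, Pi.single_eq_of_ne (hr t).symm, smul_zero,
      LinearMap.zero_apply]
  exact LinearMap.congr_fun h a

omit [Fintype ι] [DecidableEq ι'] in
theorem powDvd_shiftEmb (a : CycProd π l') : PowDvd π 1 (shiftEmb e hl a) := by
  rw [shiftEmb, prodLift, LinearMap.sum_apply]
  refine PowDvd.sum _ _ fun s _ => ?_
  obtain ⟨r, hr⟩ := Cyc.exists_smul_one π (a s)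
  simp only [LinearMap.comp_apply, LinearMap.proj_apply]
  rw [hr, map_smul, cycLift_one, Pi.single_smul]
  exact PowDvd.smul r ⟨_, by rw [pow_one]⟩

omit [Fintype ι] in
theorem exists_shiftEmb_eq (he : Function.Injective e) (hsurj : ∀ r, 2 ≤ l r → ∃ s, e s = r)
    {y : CycProd π l} (hy : PowDvd π 1 y) : ∃ a, shiftEmb e hl a = y := by
  obtain ⟨z, rfl⟩ := hy
  have hle (s : ι') : l' s ≤ l (e s) + 0 := by
    rw [hl]
    omega
  refine ⟨fun s => cycScale 0 (hle s) (z (e s)), funext fun r => ?_⟩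
  by_cases hr : ∃ s, e s = r
  · obtain ⟨s, rfl⟩ := hr
    obtain ⟨c, hc⟩ := Cyc.exists_smul_one π (z (e s))
    rw [shiftEmb_apply e hl he, hc, cycScale_smul_one, cycScale_smul_one, Pi.smul_apply, hc,
      smul_smul]
    congr 1
    ring
  · rw [shiftEmb_apply_of_notMem e hl _ (not_exists.mp hr)]
    have : l r ≤ 1 := by
      by_contra h
      exact hr (hsurj r (by omega))
    exact (Cyc.pow_smul_eq_zero π this _).symm

omit [Fintype ι] in
theorem shiftEmb_injective [IsDomain R] (hπ : π ≠ 0) (he : Function.Injective e) :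
    Function.Injective (shiftEmb (π := π) e hl) := by
  intro a b h
  funext s
  have := congrFun h (e s)
  rw [shiftEmb_apply e hl he, shiftEmb_apply e hl he] at this
  exact cycScale_injective hπ _ (by rw [hl]; omega) this

/-- The image of a generator is divisible by `π`; a quotient by `π` is the new image, and it
satisfies the relation of the generator because `l = l' + 1`. Rows outside the range of `e` go to
zero. -/
theorem exists_lift_end (f : CycProd π l' →ₗ[R] CycProd π l') (he : Function.Injective e) :
    ∃ F : CycProd π l →ₗ[R] CycProd π l, ∀ a, F (shiftEmb e hl a) = shiftEmb e hl (f a) := by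
  have h (r : ι) : ∃ u : CycProd π l, π ^ l r • u = 0 ∧
      ∀ s, e s = r → π • u = shiftEmb e hl (f (Pi.single s 1)) := by
    by_cases hr : ∃ s, e s = r
    · obtain ⟨s, rfl⟩ := hr
      obtain ⟨u, hu⟩ := powDvd_shiftEmb e hl (f (Pi.single s 1))
      rw [pow_one] at hu
      refine ⟨u, ?_, fun t ht => by rw [he ht, hu]⟩
      rw [hl, pow_succ, mul_smul, hu, ← map_smul, ← map_smul, ← Pi.single_smul,
        Cyc.pow_smul_eq_zero π le_rfl, Pi.single_zero, map_zero, map_zero]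
    · exact ⟨0, smul_zero _, fun s hs => absurd ⟨s, hs⟩ hr⟩
  choose u hu0 hu using h
  refine ⟨prodLift π u hu0, fun a => ?_⟩
  have : prodLift π u hu0 ∘ₗ shiftEmb e hl = shiftEmb e hl ∘ₗ f := by
    refine CycProd.hom_ext π fun s => ?_
    rw [LinearMap.comp_apply, shiftEmb_single, map_smul, prodLift_single, hu (e s) s rfl,
      LinearMap.comp_apply]
  exact LinearMap.congr_fun this a

omit [Fintype ι] in
theorem exists_restrict_end [IsDomain R] (hπ : π ≠ 0) (F : CycProd π l →ₗ[R] CycProd π l)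
    (he : Function.Injective e) (hsurj : ∀ r, 2 ≤ l r → ∃ s, e s = r) :
    ∃ f : CycProd π l' →ₗ[R] CycProd π l', ∀ a, shiftEmb e hl (f a) = F (shiftEmb e hl a) := by
  choose w hw using fun s : ι' => exists_shiftEmb_eq e hl he hsurj
    ((powDvd_shiftEmb e hl (Pi.single s (1 : Cyc π (l' s)))).map F)
  have h0 (s : ι') : π ^ l' s • w s = 0 := by
    apply shiftEmb_injective e hl hπ he
    rw [map_smul, hw, ← map_smul, ← map_smul, ← Pi.single_smul, Cyc.pow_smul_eq_zero π le_rfl,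
      Pi.single_zero, map_zero, map_zero]
  refine ⟨prodLift π w h0, fun a => ?_⟩
  have : shiftEmb e hl ∘ₗ prodLift π w h0 = F ∘ₗ shiftEmb e hl := by
    refine CycProd.hom_ext π fun s => ?_
    rw [LinearMap.comp_apply, prodLift_single, hw, LinearMap.comp_apply]
  exact LinearMap.congr_fun this a

/-- The lift of an automorphism need not be invertible, but lifting it and its inverse gives
endomorphisms in both directions, as `exists_linearEquiv_of_end` requires. -/
theorem exists_equiv_shiftEmb_iff [IsDomain R] [IsDiscreteValuationRing R]
    [Finite (IsLocalRing.ResidueField R)] (hπ : Irreducible π)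
    (he : Function.Injective e) (hsurj : ∀ r, 2 ≤ l r → ∃ s, e s = r) (a b a' b' : CycProd π l') :
    (∃ h : CycProd π l ≃ₗ[R] CycProd π l, h (shiftEmb e hl a) = shiftEmb e hl a' ∧
      h (shiftEmb e hl b) = shiftEmb e hl b') ↔
    ∃ g : CycProd π l' ≃ₗ[R] CycProd π l', g a = a' ∧ g b = b' := by
  have : ∀ i, Finite (Cyc π (l i)) := fun i => Cyc.finite hπ _
  have : ∀ i, Finite (Cyc π (l' i)) := fun i => Cyc.finite hπ _
  have hinj := shiftEmb_injective (π := π) e hl hπ.ne_zero he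
  constructor
  · rintro ⟨h, ha, hb⟩
    obtain ⟨f, hf⟩ := exists_restrict_end e hl hπ.ne_zero h.toLinearMap he hsurj
    obtain ⟨f', hf'⟩ := exists_restrict_end e hl hπ.ne_zero h.symm.toLinearMap he hsurj
    obtain ⟨g, hg⟩ := exists_linearEquiv_of_end (M := CycProd π l') ![a, b] ![a', b'] f f'
      (by
        intro k
        fin_cases k
        · exact hinj ((hf a).trans ha)
        · exact hinj ((hf b).trans hb))
      (by
        intro k
        fin_cases k
        · exact hinj ((hf' a').trans (h.symm_apply_eq.mpr ha.symm))
        · exact hinj ((hf' b').trans (h.symm_apply_eq.mpr hb.symm)))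
    exact ⟨g, hg 0, hg 1⟩
  · rintro ⟨g, rfl, rfl⟩
    obtain ⟨F, hF⟩ := exists_lift_end e hl g.toLinearMap he
    obtain ⟨F', hF'⟩ := exists_lift_end e hl g.symm.toLinearMap he
    obtain ⟨h, hh⟩ := exists_linearEquiv_of_end (M := CycProd π l)
      ![shiftEmb e hl a, shiftEmb e hl b] ![shiftEmb e hl (g a), shiftEmb e hl (g b)] F F'
      (by
        intro k
        fin_cases k
        · exact hF a
        · exact hF b)
      (by
        intro k
        fin_cases k
        · exact (hF' (g a)).trans (congrArg _ (g.symm_apply_apply a))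
        · exact (hF' (g b)).trans (congrArg _ (g.symm_apply_apply b)))
    exact ⟨h, hh 0, hh 1⟩

end Shift

section DeleteColumn

variable (μ : Ptn)

theorem mem_support_deleteColumn {k : ℕ} :
    k ∈ μ.deleteColumn.mult.support ↔ 0 < k ∧ k + 1 ∈ μ.mult.support := by
  rw [Finsupp.mem_support_iff, Finsupp.mem_support_iff]
  rcases Nat.eq_zero_or_pos k with rfl | h
  · simp [Ptn.mult_zero]
  · rw [μ.deleteColumn_mult k h]
    exact ⟨fun h' => ⟨h, h'⟩, fun h' => h'.2⟩

/-- The row of a partition which is obtained from a row after deletion of the first column. -/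
noncomputable def rowShift (s : Row μ.deleteColumn) : Row μ :=
  ⟨⟨s.1 + 1, ((mem_support_deleteColumn μ).mp s.1.2).2⟩,
    Fin.cast (μ.deleteColumn_mult s.1 ((mem_support_deleteColumn μ).mp s.1.2).1) s.2⟩

theorem rowShift_injective : Function.Injective (rowShift μ) := by
  rintro ⟨⟨k, hk⟩, i⟩ ⟨⟨k', hk'⟩, i'⟩ h
  have h1 : k = k' := by
    have := congrArg (fun r : Row μ => (r.1 : ℕ)) h
    simpa [rowShift] using this
  subst h1
  have h2 : (i : ℕ) = i' := by
    have := congrArg (fun r : Row μ => (r.2 : ℕ)) h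
    simpa [rowShift] using this
  rw [Fin.ext h2]

theorem exists_rowShift_eq (r : Row μ) (hr : 2 ≤ rowLen μ r) : ∃ s, rowShift μ s = r := by
  obtain ⟨⟨k, hk⟩, i⟩ := r
  obtain ⟨k, rfl⟩ : ∃ m, k = m + 1 := ⟨k - 1, by simp only [rowLen] at hr; omega⟩
  have hpos : 0 < k := by
    simp only [rowLen] at hr
    omega
  exact ⟨⟨⟨k, (mem_support_deleteColumn μ).mpr ⟨hpos, hk⟩⟩,
    Fin.cast (μ.deleteColumn_mult k hpos).symm i⟩, rfl⟩

end DeleteColumn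
-- Decomposition of the orbits of pairs.
section Pairs

theorem orbitRel_mk_eq_iff {G X : Type*} [Group G] [MulAction G X] {x x' : X} :
    (Quotient.mk (MulAction.orbitRel G X) x = Quotient.mk (MulAction.orbitRel G X) x') ↔
      ∃ g : G, g • x = x' := by
  rw [Quotient.eq, MulAction.orbitRel_apply]
  constructor
  · rintro ⟨g, rfl⟩
    exact ⟨g⁻¹, inv_smul_smul g x'⟩
  · rintro ⟨g, rfl⟩
    exact ⟨g⁻¹, inv_smul_smul g x⟩

variable {R : Type*} [CommRing R] {π : R} {μ : Ptn}

theorem powDvd_equiv_iff (h : Aut R π μ) {x : Mod R π μ} :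
    PowDvd π 1 (h x) ↔ PowDvd π 1 x := by
  constructor
  · intro hx
    have := hx.map h.symm.toLinearMap
    rwa [LinearEquiv.coe_coe, LinearEquiv.symm_apply_apply] at this
  · exact fun hx => hx.map h.toLinearMap

theorem mem_piMod_iff {H : Subgroup (Aut R π μ)} {x : Mod R π μ} :
    x ∈ piMod R π μ H ↔ PowDvd π 1 x := by
  simp only [PowDvd, pow_one]
  rfl

/-- The orbits of pairs. -/
abbrev PairOrbit (R : Type*) [CommRing R] (π : R) (μ : Ptn) :=
  MulAction.orbitRel.Quotient (Aut R π μ) (Mod R π μ × Mod R π μ)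

/-- The orbit of a pair. -/
def pairOrbit (x y : Mod R π μ) : PairOrbit R π μ :=
  Quotient.mk (MulAction.orbitRel (Aut R π μ) (Mod R π μ × Mod R π μ)) (x, y)

theorem pairOrbit_eq_iff {x y x' y' : Mod R π μ} :
    pairOrbit x y = pairOrbit x' y' ↔ ∃ h : Aut R π μ, h x = x' ∧ h y = y' := by
  rw [pairOrbit, pairOrbit, orbitRel_mk_eq_iff]
  simp only [Prod.smul_mk, Prod.mk.injEq]
  rfl

/-- The orbits of pairs whose first component is canonical, as orbits of the stabilizer. -/
noncomputable def stabToPair (I : PtnIdeal μ) :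
    MulAction.orbitRel.Quotient (Stab R π μ I) (Mod R π μ) → PairOrbit R π μ :=
  Quotient.lift (fun y => pairOrbit (canonicalElement R π μ I) y) (by
    intro y y' h
    obtain ⟨g, hg⟩ := orbitRel_mk_eq_iff.mp (Quotient.sound h)
    exact pairOrbit_eq_iff.mpr ⟨g.1, g.2, hg⟩)

/-- The orbits of pairs whose second component is canonical, and whose first component is divisible
by `π`, as orbits of the stabilizer. -/
noncomputable def stabPiToPair (I : PtnIdeal μ) :
    MulAction.orbitRel.Quotient (Stab R π μ I) (piMod R π μ (Stab R π μ I)) → PairOrbit R π μ :=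
  Quotient.lift (fun y => pairOrbit y.1 (canonicalElement R π μ I)) (by
    intro y y' h
    obtain ⟨g, hg⟩ := orbitRel_mk_eq_iff.mp (Quotient.sound h)
    exact pairOrbit_eq_iff.mpr ⟨g.1, congrArg Subtype.val hg, g.2⟩)

/-- The embedding of the module of the partition with the first column deleted. -/
noncomputable def columnEmb (R : Type*) [CommRing R] (π : R) (μ : Ptn) :
    Mod R π μ.deleteColumn →ₗ[R] Mod R π μ :=
  shiftEmb (l := rowLen μ) (l' := rowLen μ.deleteColumn) (rowShift μ) (fun _ => rfl)

variable [IsDomain R] [IsDiscreteValuationRing R] [Finite (IsLocalRing.ResidueField R)]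
  (hπ : Irreducible π)

include hπ

theorem columnEmb_equiv_iff (a b a' b' : Mod R π μ.deleteColumn) :
    (∃ h : Aut R π μ, h (columnEmb R π μ a) = columnEmb R π μ a' ∧
      h (columnEmb R π μ b) = columnEmb R π μ b') ↔
    ∃ g : Aut R π μ.deleteColumn, g a = a' ∧ g b = b' :=
  exists_equiv_shiftEmb_iff (l := rowLen μ) (l' := rowLen μ.deleteColumn) (rowShift μ)
    (fun _ => rfl) hπ (rowShift_injective μ) (exists_rowShift_eq μ) a b a' b'

/-- The orbits of pairs of elements divisible by `π`. -/
noncomputable def columnToPair : PairOrbit R π μ.deleteColumn → PairOrbit R π μ :=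
  Quotient.lift (fun p => pairOrbit (columnEmb R π μ p.1) (columnEmb R π μ p.2)) (by
    rintro ⟨a, b⟩ ⟨a', b'⟩ h
    have h' : pairOrbit a b = pairOrbit a' b' := Quotient.sound h
    exact pairOrbit_eq_iff.mpr ((columnEmb_equiv_iff hπ a b a' b').mpr (pairOrbit_eq_iff.mp h')))

theorem exists_aut_canonicalElement (a : Mod R π μ) :
    ∃ I : PtnIdeal μ, ∃ h : Aut R π μ, h (canonicalElement R π μ I) = a := by
  obtain ⟨I, h, hh⟩ := exists_linearEquiv_elem hπ a
  exact ⟨I, h, by rw [← I.antichain_elem]; exact hh⟩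

omit [IsDiscreteValuationRing R] [Finite (IsLocalRing.ResidueField R)] in
theorem eq_of_aut_canonicalElement {I J : PtnIdeal μ} (h : Aut R π μ)
    (hh : h (canonicalElement R π μ I) = canonicalElement R π μ J) : I = J := by
  rw [← I.antichain_elem, ← J.antichain_elem] at hh
  exact eq_of_linearEquiv_elem hπ h hh

omit [IsDiscreteValuationRing R] [Finite (IsLocalRing.ResidueField R)] in
theorem heightZero_iff_canonicalElement {I : PtnIdeal μ} :
    I.HeightZero ↔ ¬ PowDvd π 1 (canonicalElement R π μ I) := by
  rw [heightZero_iff hπ, I.antichain_elem]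

theorem numPairOrbits_eq_add : numPairOrbits R π μ = numPairOrbits R π μ.deleteColumn +
    ∑ᶠ (I : PtnIdeal μ) (_ : I.HeightZero),
      (numStabOrbits R π μ I + numStabOrbitsPi R π μ I) := by
  classical
  have : ∀ r : Row μ, Finite (Cyc π (rowLen μ r)) := fun r => Cyc.finite hπ _
  have : ∀ r : Row μ.deleteColumn, Finite (Cyc π (rowLen μ.deleteColumn r)) :=
    fun r => Cyc.finite hπ _
  have hfin : Finite (Mod R π μ) := inferInstanceAs (Finite (CycProd π (rowLen μ)))
  have hfin' : Finite (Mod R π μ.deleteColumn) :=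
    inferInstanceAs (Finite (CycProd π (rowLen μ.deleteColumn)))
  let Φ₁ : (Σ I : {I : PtnIdeal μ // I.HeightZero},
      MulAction.orbitRel.Quotient (Stab R π μ I.1) (Mod R π μ)) → PairOrbit R π μ :=
    fun q => stabToPair q.1.1 q.2
  let Φ₂ : (Σ I : {I : PtnIdeal μ // I.HeightZero},
      MulAction.orbitRel.Quotient (Stab R π μ I.1) (piMod R π μ (Stab R π μ I.1))) →
        PairOrbit R π μ :=
    fun q => stabPiToPair q.1.1 q.2
  have hemb (a : Mod R π μ.deleteColumn) : PowDvd π 1 (columnEmb R π μ a) := powDvd_shiftEmb _ _ a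
  have h₁ : Function.Injective Φ₁ := by
    rintro ⟨⟨I, hI⟩, q⟩ ⟨⟨J, hJ⟩, q'⟩ h
    induction q using Quotient.inductionOn with | _ y
    induction q' using Quotient.inductionOn with | _ y'
    obtain ⟨g, hx, hy⟩ := pairOrbit_eq_iff.mp h
    obtain rfl := eq_of_aut_canonicalElement hπ g hx
    congr 1
    exact orbitRel_mk_eq_iff.mpr ⟨⟨g, hx⟩, hy⟩
  have h₂ : Function.Injective Φ₂ := by
    rintro ⟨⟨I, hI⟩, q⟩ ⟨⟨J, hJ⟩, q'⟩ h
    induction q using Quotient.inductionOn with | _ y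
    induction q' using Quotient.inductionOn with | _ y'
    obtain ⟨g, hy, hx⟩ := pairOrbit_eq_iff.mp h
    obtain rfl := eq_of_aut_canonicalElement hπ g hx
    congr 1
    exact orbitRel_mk_eq_iff.mpr ⟨⟨g, hx⟩, Subtype.ext hy⟩
  have h₃ : Function.Injective (columnToPair (μ := μ) hπ) := by
    intro q q' h
    induction q using Quotient.inductionOn with | _ p
    induction q' using Quotient.inductionOn with | _ p'
    exact pairOrbit_eq_iff.mpr ((columnEmb_equiv_iff hπ _ _ _ _).mp (pairOrbit_eq_iff.mp h))
  -- The summands stand for `x ∉ πA`; `x ∈ πA` and `y ∉ πA`; both in `πA`. They are disjoint because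
  -- automorphisms preserve divisibility by `π`. The entry outside `πA` is the one made canonical.
  have hbij : Function.Bijective (Sum.elim Φ₁ (Sum.elim Φ₂ (columnToPair (μ := μ) hπ))) := by
    constructor
    · refine h₁.sumElim (h₂.sumElim h₃ ?_) ?_
      · rintro ⟨⟨I, hI⟩, q⟩ q' h
        induction q using Quotient.inductionOn with | _ y
        induction q' using Quotient.inductionOn with | _ p
        obtain ⟨g, -, hx⟩ := pairOrbit_eq_iff.mp h
        refine (heightZero_iff_canonicalElement hπ).mp hI ((powDvd_equiv_iff g).mp ?_)
        rw [hx]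
        exact hemb _
      · rintro ⟨⟨I, hI⟩, q⟩ (⟨⟨J, hJ⟩, q'⟩ | q') h
        · induction q using Quotient.inductionOn with | _ y
          induction q' using Quotient.inductionOn with | _ y'
          obtain ⟨g, hx, -⟩ := pairOrbit_eq_iff.mp h
          refine (heightZero_iff_canonicalElement hπ).mp hI ((powDvd_equiv_iff g).mp ?_)
          rw [hx]
          exact mem_piMod_iff.mp y'.2
        · induction q using Quotient.inductionOn with | _ y
          induction q' using Quotient.inductionOn with | _ p
          obtain ⟨g, hx, -⟩ := pairOrbit_eq_iff.mp h
          refine (heightZero_iff_canonicalElement hπ).mp hI ((powDvd_equiv_iff g).mp ?_)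
          rw [hx]
          exact hemb _
    · intro q
      induction q using Quotient.inductionOn with | _ p
      obtain ⟨x, y⟩ := p
      by_cases hx : PowDvd π 1 x
      · by_cases hy : PowDvd π 1 y
        · obtain ⟨a, ha⟩ := exists_shiftEmb_eq (l := rowLen μ) (l' := rowLen μ.deleteColumn)
            (rowShift μ) (fun _ => rfl) (rowShift_injective μ) (exists_rowShift_eq μ) hx
          obtain ⟨b, hb⟩ := exists_shiftEmb_eq (l := rowLen μ) (l' := rowLen μ.deleteColumn)
            (rowShift μ) (fun _ => rfl) (rowShift_injective μ) (exists_rowShift_eq μ) hy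
          refine ⟨Sum.inr (Sum.inr (pairOrbit a b)), ?_⟩
          exact congrArg₂ pairOrbit ha hb
        · obtain ⟨I, h, rfl⟩ := exists_aut_canonicalElement hπ y
          rw [powDvd_equiv_iff] at hy
          have hx' : PowDvd π 1 (h.symm x) := (powDvd_equiv_iff h.symm).mpr hx
          refine ⟨Sum.inr (Sum.inl ⟨⟨I, (heightZero_iff_canonicalElement hπ).mpr hy⟩,
            Quotient.mk _ ⟨h.symm x, mem_piMod_iff.mpr hx'⟩⟩), ?_⟩
          exact pairOrbit_eq_iff.mpr ⟨h, h.apply_symm_apply x, rfl⟩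
      · obtain ⟨I, h, rfl⟩ := exists_aut_canonicalElement hπ x
        rw [powDvd_equiv_iff] at hx
        refine ⟨Sum.inl ⟨⟨I, (heightZero_iff_canonicalElement hπ).mpr hx⟩,
            Quotient.mk _ (h.symm y)⟩, ?_⟩
        exact pairOrbit_eq_iff.mpr ⟨h, rfl, h.apply_symm_apply y⟩
  have : Finite {I : PtnIdeal μ // I.HeightZero} := inferInstance
  have := Fintype.ofFinite {I : PtnIdeal μ // I.HeightZero}
  have hQ (I : PtnIdeal μ) : Finite (MulAction.orbitRel.Quotient (Stab R π μ I) (Mod R π μ)) :=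
    Quotient.finite _
  have hQ' (I : PtnIdeal μ) : Finite (MulAction.orbitRel.Quotient (Stab R π μ I)
    (piMod R π μ (Stab R π μ I))) := Quotient.finite _
  have hP : Finite (PairOrbit R π μ.deleteColumn) := Quotient.finite _
  rw [← finsum_subtype_eq_finsum_cond, finsum_eq_sum_of_fintype, Finset.sum_add_distrib]
  rw [numPairOrbits, ← Nat.card_congr (Equiv.ofBijective _ hbij), Nat.card_sum, Nat.card_sum,
    Nat.card_sigma, Nat.card_sigma]
  exact (add_assoc _ _ _).symm.trans (add_comm _ _)

end Pairs
-- The polynomial of a partition: recursion, positivity and degree.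
section LargestPart

variable (μ : Ptn)

theorem le_largestPart {μ : Ptn} {k : ℕ} (hk : k ∈ μ.mult.support) : k ≤ μ.largestPart :=
  Finset.le_sup (f := id) hk

theorem largestPart_mem {μ : Ptn} (h : μ.largestPart ≠ 0) : μ.largestPart ∈ μ.mult.support := by
  have hne : μ.mult.support.Nonempty := by
    rw [Finset.nonempty_iff_ne_empty]
    intro h'
    exact h (by rw [Ptn.largestPart, h', Finset.sup_empty]; rfl)
  obtain ⟨k, hk, h'⟩ := Finset.exists_mem_eq_sup _ hne id
  rw [Ptn.largestPart, h']
  exact hk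

theorem largestPart_deleteColumn : μ.deleteColumn.largestPart = μ.largestPart - 1 := by
  apply le_antisymm
  · refine Finset.sup_le fun k hk => ?_
    have := le_largestPart ((mem_support_deleteColumn μ).mp hk).2
    simp only [id]
    omega
  · by_cases h : μ.largestPart ≤ 1
    · omega
    · refine le_largestPart ((mem_support_deleteColumn μ).mpr ⟨by omega, ?_⟩)
      rw [Nat.sub_add_cancel (by omega)]
      exact largestPart_mem (by omega)

end LargestPart

/-- The polynomial which counts the orbits of pairs. -/
noncomputable def pairPoly (μ : Ptn) : ℤ[X] :=
  if _h : μ.largestPart = 0 then 1 else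
    pairPoly μ.deleteColumn + ∑ᶠ (I : PtnIdeal μ) (_ : I.HeightZero),
      (I.antichain.orbitPoly 0 + I.antichain.orbitPoly 1)
termination_by μ.largestPart
decreasing_by
  rw [largestPart_deleteColumn]
  omega

theorem pairPoly_of_largestPart_eq_zero {μ : Ptn} (h : μ.largestPart = 0) : pairPoly μ = 1 := by
  rw [pairPoly, dif_pos h]

theorem not_heightZero_of_largestPart_eq_zero {μ : Ptn} (h : μ.largestPart = 0)
    (I : PtnIdeal μ) : ¬ I.HeightZero := by
  rintro ⟨p, hp, -⟩
  have h1 : p.l ∈ μ.mult.support := I.2.1 hp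
  have := le_largestPart h1
  have := p.v_lt
  omega

theorem pairPoly_eq_add (μ : Ptn) : pairPoly μ = pairPoly μ.deleteColumn +
    ∑ᶠ (I : PtnIdeal μ) (_ : I.HeightZero),
      (I.antichain.orbitPoly 0 + I.antichain.orbitPoly 1) := by
  by_cases h : μ.largestPart = 0
  -- The empty partition has no height zero ideals, so both sides are `1`.
  · rw [pairPoly_of_largestPart_eq_zero h, pairPoly_of_largestPart_eq_zero
      (by rw [largestPart_deleteColumn, h])]
    simp [not_heightZero_of_largestPart_eq_zero h]
  · conv_lhs => rw [pairPoly, dif_neg h]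

theorem numPairOrbits_eq_eval {R : Type*} [CommRing R] [IsDomain R] [IsDiscreteValuationRing R]
    [Finite (IsLocalRing.ResidueField R)] {π : R} (hπ : Irreducible π) (μ : Ptn) :
    (numPairOrbits R π μ : ℤ) =
      (pairPoly μ).eval (Nat.card (IsLocalRing.ResidueField R) : ℤ) := by
  induction hn : μ.largestPart using Nat.strong_induction_on generalizing μ with
  | _ n ih =>
    by_cases h : μ.largestPart = 0
    · rw [pairPoly_of_largestPart_eq_zero h, eval_one, numPairOrbits]
      have : IsEmpty (Row μ) := by
        refine ⟨fun r => ?_⟩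
        have := le_largestPart r.1.2
        have := one_le_rowLen r
        simp only [rowLen] at this
        omega
      have : Subsingleton (MulAction.orbitRel.Quotient (Aut R π μ) (Mod R π μ × Mod R π μ)) :=
        Quotient.instSubsingletonQuotient _
      have : Nonempty (MulAction.orbitRel.Quotient (Aut R π μ) (Mod R π μ × Mod R π μ)) :=
        ⟨Quotient.mk _ (0, 0)⟩
      rw [Nat.card_unique, Nat.cast_one]
    · have := Fintype.ofFinite {I : PtnIdeal μ // I.HeightZero}
      rw [numPairOrbits_eq_add hπ, pairPoly_eq_add, ← finsum_subtype_eq_finsum_cond,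
        finsum_eq_sum_of_fintype, ← finsum_subtype_eq_finsum_cond, finsum_eq_sum_of_fintype,
        eval_add, eval_finsetSum, Nat.cast_add, Nat.cast_sum,
        ih _ (by rw [largestPart_deleteColumn]; omega) μ.deleteColumn rfl]
      congr 1
      refine Finset.sum_congr rfl fun I _ => ?_
      rw [Nat.cast_add, numStabOrbits_eq_eval _ hπ, numStabOrbitsPi_eq_eval _ hπ, eval_add]

theorem nonnegCoeffs_pairPoly {Λ : Set Ptn} (h1 : ∀ μ ∈ Λ, μ.deleteColumn ∈ Λ)
    (h2 : ∀ μ ∈ Λ, NonnegCoeffs (pairPoly μ - pairPoly μ.deleteColumn)) (μ : Ptn) (hμ : μ ∈ Λ) :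
    NonnegCoeffs (pairPoly μ) := by
  induction hn : μ.largestPart using Nat.strong_induction_on generalizing μ with
  | _ n ih =>
    by_cases h : μ.largestPart = 0
    · rw [pairPoly_of_largestPart_eq_zero h, ← pow_zero X]
      exact NonnegCoeffs.X_pow 0
    · rw [← add_sub_cancel (pairPoly μ.deleteColumn) (pairPoly μ)]
      exact (ih _ (by rw [largestPart_deleteColumn]; omega) _ (h1 μ hμ) rfl).add (h2 μ hμ)

theorem nonnegCoeffs_orbitPoly_of_principal {μ : Ptn} {I : PtnIdeal μ} (h0 : I.HeightZero)
    (hp : I.IsPrincipal) {j : ℕ} (hj : j ≤ 1) : NonnegCoeffs (I.antichain.orbitPoly j) := by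
  obtain ⟨r, hS, hv⟩ := PtnIdeal.antichain_of_principal h0 hp
  exact I.antichain.nonnegCoeffs_orbitPoly hS hv fun i => hj.trans (one_le_rowLen i)

theorem natDegree_orbitPoly_le_of_principal {μ : Ptn} {I : PtnIdeal μ} (h0 : I.HeightZero)
    (hp : I.IsPrincipal) {j : ℕ} (hj : j ≤ 1) :
    (I.antichain.orbitPoly j).natDegree ≤ μ.largestPart := by
  obtain ⟨r, hS, hv⟩ := PtnIdeal.antichain_of_principal h0 hp
  exact (I.antichain.natDegree_orbitPoly_le hS hv fun i => hj.trans (one_le_rowLen i)).trans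
    (le_largestPart r.1.2)

/-- The principal ideal of height zero with maximal element `(0, k)`. -/
def principalIdeal {μ : Ptn} {k : ℕ} (hk : k ∈ μ.mult.support) : PtnIdeal μ :=
  have hmax : maxSet (LowerSet.Iic ⟨0, k, pos_of_mem_support hk⟩) =
      {(⟨0, k, pos_of_mem_support hk⟩ : FundPoset)} := by
    ext p
    constructor
    · intro hp
      exact le_antisymm hp.1 (hp.2 (LowerSet.mem_Iic_iff.mpr le_rfl) hp.1)
    · rintro rfl
      exact ⟨LowerSet.mem_Iic_iff.mpr le_rfl, fun _ h _ => h⟩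
  ⟨LowerSet.Iic ⟨0, k, pos_of_mem_support hk⟩, by
    rw [hmax, Set.singleton_subset_iff]
    exact hk, by
    rw [hmax, lowerClosure_singleton]⟩

theorem mem_maxSet_principalIdeal {μ : Ptn} {k : ℕ} (hk : k ∈ μ.mult.support) :
    (⟨0, k, pos_of_mem_support hk⟩ : FundPoset) ∈ maxSet (principalIdeal hk).1 :=
  ⟨LowerSet.mem_Iic_iff.mpr le_rfl, fun _ h _ => h⟩

theorem coeff_orbitPoly_pos_of_mem {μ : Ptn} {I : PtnIdeal μ} {p : FundPoset}
    (hpI : p ∈ maxSet I.1) (hv : p.v = 0) (hp : I.IsPrincipal) :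
    0 < (I.antichain.orbitPoly 0).coeff p.l := by
  obtain ⟨r, hS, hv⟩ := PtnIdeal.antichain_of_principal ⟨p, hpI, hv⟩ hp
  obtain ⟨r', hr', hl, -⟩ := PtnIdeal.exists_mem_rowSet hpI
  have hr : r' ∈ I.antichain.S := hr'
  rw [hS, Finset.mem_singleton] at hr
  rw [hl, hr]
  exact I.antichain.coeff_orbitPoly_pos hS hv

/-- The parts of the partition differ by at most one. -/
def PartsClose (μ : Ptn) : Prop := ∀ k ∈ μ.mult.support, ∀ k' ∈ μ.mult.support, k ≤ k' + 1

/-- `nearRectangular` lacks the empty partition and so is not stable under column deletion;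
`PartsClose` is, and carries the induction. -/
theorem PartsClose.deleteColumn {μ : Ptn} (h : PartsClose μ) : PartsClose μ.deleteColumn := by
  intro k hk k' hk'
  have := h _ ((mem_support_deleteColumn μ).mp hk).2 _ ((mem_support_deleteColumn μ).mp hk').2
  omega

/-- A second maximal element `(v', l')` beside `(0, l)` would have `v' > 0` and `l' - v' > l`, hence
`l' ≥ l + 2`. -/
theorem PartsClose.isPrincipal {μ : Ptn} (h : PartsClose μ) {I : PtnIdeal μ}
    (h0 : I.HeightZero) : I.IsPrincipal := by
  obtain ⟨p, hp, hv⟩ := h0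
  have key (p' : FundPoset) (hp' : p' ∈ maxSet I.1) : p' = p := by
    rcases lt_trichotomy p'.l p.l with hlt | heq | hgt
    · have := lt_of_mem_maxSet hp' hp hlt
      omega
    · exact eq_of_mem_maxSet_of_l_eq hp' hp heq
    · have h1 := lt_of_mem_maxSet hp hp' hgt
      have h2 := h p'.l (I.2.1 hp') p.l (I.2.1 hp)
      omega
  intro p₁ h₁ p₂ h₂
  rw [key p₁ h₁, key p₂ h₂]

theorem partsClose_of_mem_nearRectangular {μ : Ptn} (h : μ ∈ nearRectangular) : PartsClose μ := by
  intro k hk k' hk'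
  rcases h with ⟨a, ρ, σ, ha, -, -, h⟩ | ⟨a, ρ, -, -, h⟩
  · rw [h] at hk hk'
    have h1 := Finset.mem_union.mp (Finsupp.support_add hk)
    have h2 := Finset.mem_union.mp (Finsupp.support_add hk')
    have h3 {a ρ k : ℕ} (h : k ∈ (Finsupp.single a ρ).support) : k = a :=
      Finset.mem_singleton.mp (Finsupp.support_single_subset h)
    rcases h1 with h1 | h1 <;> rcases h2 with h2 | h2 <;> rw [h3 h1, h3 h2] <;> omega
  · rw [h] at hk hk'
    have h3 {a ρ k : ℕ} (h : k ∈ (Finsupp.single a ρ).support) : k = a :=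
      Finset.mem_singleton.mp (Finsupp.support_single_subset h)
    rw [h3 hk, h3 hk']
    omega

theorem PartsClose.natDegree_pairPoly {μ : Ptn} (h : PartsClose μ) :
    (pairPoly μ).natDegree = μ.largestPart ∧ NonnegCoeffs (pairPoly μ) := by
  induction hn : μ.largestPart using Nat.strong_induction_on generalizing μ with
  | _ n ih =>
    subst hn
    by_cases h0 : μ.largestPart = 0
    · rw [pairPoly_of_largestPart_eq_zero h0, h0, ← pow_zero X]
      exact ⟨by simp, NonnegCoeffs.X_pow 0⟩
    · obtain ⟨ih1, ih2⟩ := ih μ.deleteColumn.largestPart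
        (by rw [largestPart_deleteColumn]; omega) h.deleteColumn rfl
      have := Fintype.ofFinite {I : PtnIdeal μ // I.HeightZero}
      have hI (I : {I : PtnIdeal μ // I.HeightZero}) :
          NonnegCoeffs (I.1.antichain.orbitPoly 0 + I.1.antichain.orbitPoly 1) :=
        (nonnegCoeffs_orbitPoly_of_principal I.2 (h.isPrincipal I.2) zero_le_one).add
          (nonnegCoeffs_orbitPoly_of_principal I.2 (h.isPrincipal I.2) le_rfl)
      rw [pairPoly_eq_add, ← finsum_subtype_eq_finsum_cond, finsum_eq_sum_of_fintype]
      refine ⟨natDegree_eq_of_le_of_coeff_ne_zero ?_ ?_, ih2.add (NonnegCoeffs.sum _ _ fun I _ => hI I)⟩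
      · refine natDegree_add_le_of_degree_le ?_ (natDegree_sum_le_of_forall_le _ _ fun I _ => ?_)
        · rw [ih1, largestPart_deleteColumn]
          omega
        · exact natDegree_add_le_of_degree_le
            (natDegree_orbitPoly_le_of_principal I.2 (h.isPrincipal I.2) zero_le_one)
            (natDegree_orbitPoly_le_of_principal I.2 (h.isPrincipal I.2) le_rfl)
      -- The ideal of `(0, λ₁)` has a positive coefficient in degree `λ₁`, and no other term can
      -- cancel it.
      · have hmem := mem_maxSet_principalIdeal (largestPart_mem h0)
        have hz : (principalIdeal (largestPart_mem h0)).HeightZero := ⟨_, hmem, rfl⟩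
        have h1 := coeff_orbitPoly_pos_of_mem hmem rfl (h.isPrincipal hz)
        have h2 := nonnegCoeffs_orbitPoly_of_principal hz (h.isPrincipal hz) le_rfl μ.largestPart
        have h3 := ih2 μ.largestPart
        have h4 := Finset.single_le_sum (s := Finset.univ)
          (f := fun I : {I : PtnIdeal μ // I.HeightZero} =>
            (I.1.antichain.orbitPoly 0 + I.1.antichain.orbitPoly 1).coeff μ.largestPart)
          (fun I _ => hI I _) (Finset.mem_univ ⟨_, hz⟩)
        simp only [coeff_add] at h4
        rw [coeff_add, finsetSum_coeff]
        simp only [coeff_add]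
        apply ne_of_gt
        simp only at h1
        linarith

end OrbitPairs

open OrbitPairs
theorem mainTheorem1 :
    -- the polynomials `n_λ`, `n_{λ,I}` and `n¹_{λ,I}`
    ∃ (n : Ptn → Polynomial ℤ) (nStab nStabPi : ∀ μ : Ptn, PtnIdeal μ → Polynomial ℤ),
      -- they count orbits, for all discrete valuation rings with finite residue field
      (∀ (R : Type u) [CommRing R] [IsDomain R] [IsDiscreteValuationRing R]
          [Finite (IsLocalRing.ResidueField R)] (π : R), Irreducible π →
          ∀ q : ℕ, Nat.card (IsLocalRing.ResidueField R) = q →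
          ∀ μ : Ptn,
            (numPairOrbits R π μ : ℤ) = (n μ).eval (q : ℤ) ∧
            ∀ I : PtnIdeal μ,
              (numStabOrbits R π μ I : ℤ) = (nStab μ I).eval (q : ℤ) ∧
              (numStabOrbitsPi R π μ I : ℤ) = (nStabPi μ I).eval (q : ℤ)) ∧
      -- (1) height zero principal ideals
      (∀ (μ : Ptn) (I : PtnIdeal μ), I.HeightZero → I.IsPrincipal →
          NonnegCoeffs (nStab μ I) ∧ NonnegCoeffs (nStabPi μ I)) ∧
      -- (2) the difference formula and the condition for positivity
      (∀ μ : Ptn, n μ - n μ.deleteColumn =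
          ∑ᶠ (I : PtnIdeal μ) (_ : I.HeightZero), (nStab μ I + nStabPi μ I)) ∧
      (∀ Λ : Set Ptn, (∀ μ ∈ Λ, μ.deleteColumn ∈ Λ) →
          (∀ μ ∈ Λ, NonnegCoeffs (n μ - n μ.deleteColumn)) →
          ∀ μ ∈ Λ, NonnegCoeffs (n μ)) ∧
      -- (3) the positivity conjecture for two families of partitions
      (∀ μ ∈ nearRectangular, (n μ).natDegree = μ.largestPart ∧ NonnegCoeffs (n μ)) := by
  refine ⟨pairPoly, fun _ I => I.antichain.orbitPoly 0, fun _ I => I.antichain.orbitPoly 1,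
    ?_, ?_, ?_, ?_, ?_⟩
  · rintro R _ _ _ _ π hπ q rfl μ
    exact ⟨numPairOrbits_eq_eval hπ μ, fun I =>
      ⟨numStabOrbits_eq_eval I hπ, numStabOrbitsPi_eq_eval I hπ⟩⟩
  · exact fun μ I h0 hp => ⟨nonnegCoeffs_orbitPoly_of_principal h0 hp zero_le_one,
      nonnegCoeffs_orbitPoly_of_principal h0 hp le_rfl⟩
  · intro μ
    rw [pairPoly_eq_add μ, add_sub_cancel_left]
  · exact fun Λ h1 h2 => nonnegCoeffs_pairPoly h1 h2
  · exact fun μ hμ => (partsClose_of_mem_nearRectangular hμ).natDegree_pairPoly
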